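/- Let $\lambda$ be Lebesgue measure on $\mathbb{R}^d$. For a locally finite Borel measure $\mu$ on $\mathbb{R}^d$ and $t\in\mathbb{R}^d$ let $\theta_t\mu(B)=\mu(B+t)$. Let $(E,\mathcal{E})$ be a measurable space with an action $(t,x)\mapsto\theta_t x$ of the additive group $\mathbb{R}^d$ that is jointly measurable in $(t,x)$, and put $\theta_t(x,\mu)=(\theta_t x,\theta_t\mu)$. Let $P$ be a measure (not necessarily finite) on a measurable space $(\Omega,\mathcal{F})$, let $X$ be a random element of $E$ and $\xi$ a random measure on $\mathbb{R}^d$ (that is, a random element of the space of locally finite measures), such that the law of $(X,\xi)$ under $P$ is $\sigma$-finite. Suppose that $(X,\xi)$ is stationary under $P$, i.e. $\theta_t(X,\xi)\overset{D}{=}(X,\xi)$ for all $t\in\mathbb{R}^d$, and that $\operatorname{conv}(\operatorname{supp}\xi)=\mathbb{R}^d$ holds $P$-a.e. Let $N=\{i\in\mathbb{Z}^d:\xi(i+[0,1)^d)>0\}$. Associate to each $i\in\mathbb{Z}^d$ the point of $N$ closest to $i$ in Euclidean distance, taking the lexicographically lowest one if there are several; this partitions $\mathbb{Z}^d$ into cells,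 each containing exactly one point of $N$. Let $D$ be the cell containing $0$, let $S$ be the vector from the point of $N$ in $D$ to $0$, and let $D^\circ=S+D$. Let $T$ be a random vector in $[0,1)^d$ whose conditional distribution given $(X,\xi)$ under $P$ is $(\theta_{-S}\xi)(\,\cdot\mid[0,1)^d)$. Then $|D|<\infty$ $P$-a.e. Put $$(X^\circ,\xi^\circ)=\theta_T\theta_{-S}(X,\xi),\qquad dP^\circ=\frac{\theta_{-S}\xi([0,1)^d)}{|D|}\,dP .$$ Under $P^\circ$ the following hold. (a) $(X^\circ,\xi^\circ)$ is mass-stationary. That is: its law is $\sigma$-finite; $0\in\operatorname{supp}\xi^\circ$ a.e.; and for every bounded Borel set $C\subset\mathbb{R}^d$ with $\lambda(C)>0$ and $\lambda(\partial C)=0$, if $U_C$ is conditionally uniform on $C$ given $(X^\circ,\xi^\circ)$, and $V_C$ has conditional distribution $\xi^\circ(\,\cdot\mid C-U_C)$ given $((X^\circ,\xi^\circ),U_C)$, then $(\theta_{V_C}(X^\circ,\xi^\circ),V_C+U_C)\overset{D}{=}((X^\circ,\xi^\circ),U_C)$. (b) The conditional distribution of $T$ given $(X^\circ,\xi^\circ)$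 is uniform on $[0,1)^d$. (c) The conditional distribution of $S$ given $((X^\circ,\xi^\circ),T)$ is uniform on $D^\circ$. (d) $(X^\circ,\xi^\circ)$ is the Palm version of $(X,\xi)$ under $P$. That is, for every measurable $f\ge 0$ and every Borel set $B\subset\mathbb{R}^d$ with $0<\lambda(B)<\infty$, $$\int f(X^\circ,\xi^\circ)\,dP^\circ=\frac{1}{\lambda(B)}\int\Big(\int_B f(\theta_t(X,\xi))\,\xi(dt)\Big)\,dP .$$ -/

import Mathlib

open MeasureTheory ProbabilityTheory
open scoped ENNReal

namespace RandomMeasure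

/-- Euclidean space `ℝ^d`. -/
abbrev Vec (d : ℕ) : Type := EuclideanSpace ℝ (Fin d)

/-- Locally finite Borel measures on `ℝ^d`, with the σ-algebra generated by the evaluations
`μ ↦ μ B`, `B` Borel.  A random measure is a measurable map into this space. -/
abbrev LocFinMeasure (d : ℕ) : Type := {μ : Measure (Vec d) // IsLocallyFiniteMeasure μ}

theorem isLocallyFiniteMeasure_shift {d : ℕ} (t : Vec d) (μ : Measure (Vec d))
    [IsLocallyFiniteMeasure μ] : IsLocallyFiniteMeasure (μ.map fun x => x - t) := by
  refine ⟨fun x => ?_⟩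
  obtain ⟨s, hxs, hs, hμ⟩ := μ.exists_isOpen_measure_lt_top (x + t)
  refine ⟨(fun y => y + t) ⁻¹' s, (hs.preimage (by fun_prop)).mem_nhds hxs, ?_⟩
  rw [Measure.map_apply (by fun_prop) ((hs.preimage (by fun_prop)).measurableSet)]
  simpa [Set.preimage_preimage] using hμ

/-- The shift `θ_t μ`, given by `θ_t μ (B) = μ (B + t)`. -/
noncomputable def shift {d : ℕ} (t : Vec d) (μ : LocFinMeasure d) : LocFinMeasure d :=
  ⟨μ.1.map fun x => x - t, haveI := μ.2; isLocallyFiniteMeasure_shift t μ.1⟩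

theorem shift_apply {d : ℕ} (t : Vec d) (μ : LocFinMeasure d) {B : Set (Vec d)}
    (hB : MeasurableSet B) : (shift t μ).1 B = μ.1 ((fun x => x + t) '' B) := by
  rw [shift, Measure.map_apply (by fun_prop) hB]
  congr 1
  ext x
  simp [sub_eq_add_neg]

/-- The joint shift `θ_t (x, μ) = (θ_t x, θ_t μ)`. -/
noncomputable def pairShift {d : ℕ} {E : Type*} [AddAction (Vec d) E] (t : Vec d)
    (z : E × LocFinMeasure d) : E × LocFinMeasure d :=
  (t +ᵥ z.1, shift t z.2)

/-- `(X, ξ)` is stationary under `P`. -/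
def IsStationary {d : ℕ} {Ω E : Type*} [MeasurableSpace Ω] [MeasurableSpace E]
    [AddAction (Vec d) E] (P : Measure Ω) (Z : Ω → E × LocFinMeasure d) : Prop :=
  ∀ t : Vec d, P.map (fun ω => pairShift t (Z ω)) = P.map Z

/-- Under `P`, the conditional distribution of `Y` given `Z` is the random probability measure
`κ`: outside a `P`-null set, `κ` is a probability kernel evaluated at `Z`, and this kernel
disintegrates the joint law of `(Z, Y)`. -/
def CondLawIs {Ω α β : Type*} [MeasurableSpace Ω] [MeasurableSpace α] [MeasurableSpace β]
    (P : Measure Ω) (Y : Ω → β) (Z : Ω → α) (κ : Ω → Measure β) : Prop :=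
  ∃ K : Kernel α β, IsMarkovKernel K ∧ HasCondDistrib Y Z K P ∧ ∀ᵐ ω ∂P, K (Z ω) = κ ω

/-- `Z = (X, ξ)` is mass-stationary under `P`: its law is σ-finite, `0 ∈ supp ξ` almost
everywhere, and for every bounded Borel set `C` with `λ(C) > 0` and `λ(∂C) = 0`, if `U` is uniform
on `C` given `Z`, and `V` has the conditional distribution `ξ(· | C - U)` given `(Z, U)`, then
`(θ_V Z, V + U)` has the same law as `(Z, U)`.  The measure `W` is the (unique) law of `(Z, U, V)`. -/
def IsMassStationary {d : ℕ} {Ω E : Type*} [MeasurableSpace Ω] [MeasurableSpace E]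
    [AddAction (Vec d) E] (P : Measure Ω) (Z : Ω → E × LocFinMeasure d) : Prop :=
  SigmaFinite (P.map Z) ∧
  (∀ᵐ ω ∂P, (0 : Vec d) ∈ (Z ω).2.1.support) ∧
  ∀ C : Set (Vec d), MeasurableSet C → Bornology.IsBounded C → 0 < volume C →
    volume (frontier C) = 0 →
    ∃ W : Measure ((E × LocFinMeasure d) × Vec d × Vec d),
      W.map (fun w => w.1) = P.map Z ∧
      CondLawIs W (fun w => w.2.1) (fun w => w.1) (fun _ => cond volume C) ∧
      CondLawIs W (fun w => w.2.2) (fun w => (w.1, w.2.1))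
        (fun w => cond w.1.2.1 {v : Vec d | v + w.2.1 ∈ C}) ∧
      W.map (fun w => (pairShift w.2.2 w.1, w.2.2 + w.2.1)) = W.map (fun w => (w.1, w.2.1))

/-- `Z₀` under `P₀` is the Palm version of the stationary pair `Z = (X, ξ)` under `P`. -/
def IsPalmVersion {d : ℕ} {Ω₀ Ω E : Type*} [MeasurableSpace Ω₀] [MeasurableSpace Ω]
    [MeasurableSpace E] [AddAction (Vec d) E] (P₀ : Measure Ω₀) (Z₀ : Ω₀ → E × LocFinMeasure d)
    (P : Measure Ω) (Z : Ω → E × LocFinMeasure d) : Prop :=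
  ∀ f : E × LocFinMeasure d → ℝ≥0∞, Measurable f →
    ∀ B : Set (Vec d), MeasurableSet B → 0 < volume B → volume B < ∞ →
      ∫⁻ ω, f (Z₀ ω) ∂P₀ =
        (∫⁻ ω, ∫⁻ t in B, f (pairShift t (Z ω)) ∂(Z ω).2.1 ∂P) / volume B

/-- The inclusion of `ℤ^d` in `ℝ^d`. -/
noncomputable def lat {d : ℕ} (i : Fin d → ℤ) : Vec d := WithLp.toLp 2 fun k => (i k : ℝ)

/-- The half-open box `i + [0,1)^d`. -/
def box {d : ℕ} (i : Fin d → ℤ) : Set (Vec d) :=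
  {x | ∀ k, (i k : ℝ) ≤ x k ∧ x k < (i k : ℝ) + 1}

/-- The points `i ∈ ℤ^d` of the lattice process `N`: those with `μ (i + [0,1)^d) > 0`. -/
def latticePoints {d : ℕ} (μ : LocFinMeasure d) : Set (Fin d → ℤ) := {i | 0 < μ.1 (box i)}

/-- `p` is the point of `N` closest to `i` in Euclidean distance, and the lexicographically
lowest among the closest ones. -/
def IsNearest {d : ℕ} (μ : LocFinMeasure d) (i p : Fin d → ℤ) : Prop :=
  p ∈ latticePoints μ ∧ ∀ q ∈ latticePoints μ,
    dist (lat i) (lat p) < dist (lat i) (lat q) ∨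
      (dist (lat i) (lat p) = dist (lat i) (lat q) ∧ toLex p ≤ toLex q)

open Classical in
/-- The point of `N` to which `i` is associated (by convention `i` itself if `N` is empty). -/
noncomputable def nearest {d : ℕ} (μ : LocFinMeasure d) (i : Fin d → ℤ) : Fin d → ℤ :=
  if h : ∃ p, IsNearest μ i p then h.choose else i

/-- The cell `D_i` containing `i`. -/
noncomputable def cell {d : ℕ} (μ : LocFinMeasure d) (i : Fin d → ℤ) : Set (Fin d → ℤ) :=
  {j | nearest μ j = nearest μ i}

/-- The vector `S_i` from the point of `N` in `D_i` to `i`. -/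
noncomputable def offset {d : ℕ} (μ : LocFinMeasure d) (i : Fin d → ℤ) : Fin d → ℤ :=
  i - nearest μ i

/-- The cell `D° = S + D` of the origin, re-centred at its point of `N`, where `D = D_0` and
`S = S_0`. -/
noncomputable def centredCell {d : ℕ} (μ : LocFinMeasure d) : Set (Fin d → ℤ) :=
  (fun j => offset μ 0 + j) '' cell μ 0

end RandomMeasure

open RandomMeasure

namespace RandomMeasure

variable {d : ℕ} {E : Type*} [AddAction (Vec d) E]

/-! Everything follows from the joint law of `(X°, ξ°)`, `T`, `S` under `P°`. Let `M` be the
shift-invariant law of `(X, ξ)`. `lintegral_recentred_law` says that this joint law is obtained by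
drawing `z` from `M`, picking `t` in the unit box by the mass of `z` (unnormalised), shifting by
`t`, and choosing `j` uniformly in the cell of the origin. The reason is mass transport on the
lattice (`lintegral_recentre`): split according to the point `i` of `N` that serves the origin and
shift by `i`. Invariance of `M` turns an expectation at a random site of a cell into a sum over all
sites of the cell whose centre is the origin. The factor `1/|D|` makes that sum an average, and the
factor `θ_{-S}ξ([0,1)^d)` cancels the normalisation of `T`. Forgetting `t` and `j` leaves the Palm
measure of `M`. The refined Campbell formula (`lintegral_campbell`) shows that the Palm measure does
not depend on the window and that `T` is uniform and independent of the Palm pair. The choice of `j`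
gives the law of `S`, since shifting back by `T` recovers the cell. Mass-stationarity is a property
of every Palm measure. It follows from Mecke's exchange formula (`lintegral_palm_exchange`), because
the mass of the window `C - U` is the same seen from the old and from the new origin. Cells are
finite because an infinite one has a limiting direction `u`, and the bisector inequalities then
confine `N`, hence the support, to a half-space (`finite_cell`). -/

instance isLocallyFiniteMeasure_val (μ : LocFinMeasure d) : IsLocallyFiniteMeasure μ.1 := μ.2

/-! ### Half-open boxes -/

theorem mem_box_iff_floor {i : Fin d → ℤ} {x : Vec d} : x ∈ box i ↔ (fun k => ⌊x k⌋) = i := by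
  simp [box, funext_iff, Int.floor_eq_iff]

theorem measurableSet_box (i : Fin d → ℤ) : MeasurableSet (box i : Set (Vec d)) := by
  have : (box i : Set (Vec d)) = ⋂ k, {x | (i k : ℝ) ≤ x k ∧ x k < (i k : ℝ) + 1} := by
    ext; simp [box]
  rw [this]
  refine MeasurableSet.iInter fun k => ?_
  have hk : Measurable fun x : Vec d => x k := by fun_prop
  exact (measurableSet_le measurable_const hk).inter (measurableSet_lt hk measurable_const)

theorem iUnion_box : ⋃ i, (box i : Set (Vec d)) = Set.univ :=
  Set.eq_univ_of_forall fun _ => Set.mem_iUnion.2 ⟨_, mem_box_iff_floor.2 rfl⟩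

theorem pairwise_disjoint_box :
    Pairwise (Function.onFun Disjoint fun i => (box i : Set (Vec d))) := by
  intro i j hij
  refine Set.disjoint_left.2 fun x hi hj => hij ?_
  rw [← mem_box_iff_floor.1 hi, ← mem_box_iff_floor.1 hj]

theorem add_lat_mem_box_iff {i j : Fin d → ℤ} {x : Vec d} :
    x + lat j ∈ box i ↔ x ∈ box (i - j) := by
  simp only [box, lat, Set.mem_ofPred_eq, PiLp.add_apply, Pi.sub_apply, Int.cast_sub]
  refine forall_congr' fun k => ?_
  constructor <;> rintro ⟨h₁, h₂⟩ <;> constructor <;> linarith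

theorem isBounded_box (i : Fin d → ℤ) : Bornology.IsBounded (box i : Set (Vec d)) := by
  have h : box i ⊆ (WithLp.ofLp : Vec d → Fin d → ℝ) ⁻¹'
      Set.Icc (fun k => (i k : ℝ)) (fun k => (i k : ℝ) + 1) := by
    intro x hx
    exact ⟨fun k => (hx k).1, fun k => (hx k).2.le⟩
  refine Bornology.IsBounded.subset ?_ h
  exact (PiLp.antilipschitzWith_ofLp 2 (fun _ : Fin d => ℝ)).isBounded_preimage
    (Metric.isBounded_Icc _ _)

theorem measure_box_lt_top (μ : LocFinMeasure d) (i : Fin d → ℤ) : μ.1 (box i) < ∞ :=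
  (isBounded_box i).measure_lt_top

theorem volume_box_zero : volume (box 0 : Set (Vec d)) = 1 := by
  have h : (box 0 : Set (Vec d)) = (WithLp.ofLp : Vec d → Fin d → ℝ) ⁻¹'
      Set.univ.pi fun _ => Set.Ico 0 1 := by
    ext x; simp [box]
  rw [h, (PiLp.volume_preserving_ofLp (Fin d)).measure_preimage
    (MeasurableSet.univ_pi fun _ => measurableSet_Ico).nullMeasurableSet, volume_pi_pi]
  simp

theorem sum_restrict_box (μ : Measure (Vec d)) :
    μ = Measure.sum fun i : Fin d → ℤ => μ.restrict (box i) := by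
  rw [← Measure.restrict_iUnion pairwise_disjoint_box measurableSet_box, iUnion_box,
    Measure.restrict_univ]

/-! ### Measurability -/

theorem measurable_val : Measurable fun μ : LocFinMeasure d => μ.1 := measurable_subtype_coe

theorem measurable_eval {B : Set (Vec d)} (hB : MeasurableSet B) :
    Measurable fun μ : LocFinMeasure d => μ.1 B :=
  (Measure.measurable_coe hB).comp measurable_val

/-- A random measure, as a kernel from the space of locally finite measures. -/
noncomputable def evalKernel (d : ℕ) : Kernel (LocFinMeasure d) (Vec d) :=
  ⟨fun μ => μ.1, measurable_val⟩

theorem evalKernel_apply (μ : LocFinMeasure d) : evalKernel d μ = μ.1 := rfl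

/-- Box masses are finite but not bounded uniformly in the measure. Cutting further by the integer
part of the box mass gives countably many bounded kernels. This is what makes integrals against a
random measure measurable in their parameters. -/
instance isSFiniteKernel_evalKernel : IsSFiniteKernel (evalKernel d) := by
  classical
  let s : (Fin d → ℤ) × ℕ → Set (LocFinMeasure d) := fun p =>
    {μ | μ.1 (box p.1) ∈ Set.Ico (p.2 : ℝ≥0∞) (p.2 + 1)}
  have hs : ∀ p, MeasurableSet (s p) := fun p =>
    measurable_eval (measurableSet_box p.1) measurableSet_Ico
  let κ : (Fin d → ℤ) × ℕ → Kernel (LocFinMeasure d) (Vec d) := fun p =>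
    Kernel.piecewise (hs p) ((evalKernel d).restrict (measurableSet_box p.1)) 0
  have hκ : ∀ p, IsFiniteKernel (κ p) := by
    intro p
    refine ⟨⟨p.2 + 1, by finiteness, fun μ => ?_⟩⟩
    by_cases h : μ ∈ s p
    · simpa [κ, Kernel.piecewise_apply, h, Kernel.restrict_apply, evalKernel_apply] using h.2.le
    · simp [κ, Kernel.piecewise_apply, h]
  have hsum : evalKernel d = Kernel.sum κ := by
    ext μ A hA
    rw [Kernel.sum_apply' _ _ hA, evalKernel_apply]
    conv_lhs => rw [sum_restrict_box μ.1]
    rw [Measure.sum_apply _ hA, ENNReal.summable.tsum_prod' fun _ => ENNReal.summable]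
    refine tsum_congr fun i => ?_
    obtain ⟨r, hr⟩ : ∃ r : NNReal, (r : ℝ≥0∞) = μ.1 (box i) :=
      ⟨_, ENNReal.coe_toNNReal (measure_box_lt_top μ i).ne⟩
    have hn : ∀ n : ℕ, μ ∈ s (i, n) ↔ n = ⌊r⌋₊ := by
      intro n
      have h1 : μ ∈ s (i, n) ↔ (n : NNReal) ≤ r ∧ r < (n : NNReal) + 1 := by
        change μ.1 (box i) ∈ Set.Ico (n : ℝ≥0∞) (n + 1) ↔ _
        rw [← hr, Set.mem_Ico]
        norm_cast
      rw [h1, eq_comm, Nat.floor_eq_iff zero_le]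
    rw [tsum_eq_single ⌊r⌋₊]
    · simp [κ, Kernel.piecewise_apply, (hn _).2 rfl, Kernel.restrict_apply,
        evalKernel_apply]
    · intro n hne
      simp [κ, Kernel.piecewise_apply, mt (hn _).1 hne]
  rw [hsum]
  infer_instance

theorem _root_.Measurable.lintegral_locFinMeasure {α : Type*} [MeasurableSpace α]
    {m : α → LocFinMeasure d} (hm : Measurable m) {f : α → Vec d → ℝ≥0∞}
    (hf : Measurable (Function.uncurry f)) : Measurable fun a => ∫⁻ t, f a t ∂(m a).1 :=
  hf.lintegral_kernel_prod_right (κ := (evalKernel d).comap m hm)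

theorem _root_.Measurable.setLIntegral_locFinMeasure {α : Type*} [MeasurableSpace α]
    {m : α → LocFinMeasure d} (hm : Measurable m) {f : α → Vec d → ℝ≥0∞}
    (hf : Measurable (Function.uncurry f)) {B : Set (Vec d)} (hB : MeasurableSet B) :
    Measurable fun a => ∫⁻ t in B, f a t ∂(m a).1 := by
  have : Measurable (Function.uncurry fun a t => B.indicator (f a) t) :=
    hf.indicator (measurable_snd hB)
  simpa only [lintegral_indicator hB] using hm.lintegral_locFinMeasure this

/-! ### Shifts -/

theorem lintegral_shift (t : Vec d) (μ : LocFinMeasure d) {f : Vec d → ℝ≥0∞} (hf : Measurable f) :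
    ∫⁻ x, f x ∂(shift t μ).1 = ∫⁻ x, f (x - t) ∂μ.1 :=
  lintegral_map hf (by fun_prop)

theorem shift_apply_preimage (t : Vec d) (μ : LocFinMeasure d) {B : Set (Vec d)}
    (hB : MeasurableSet B) : (shift t μ).1 B = μ.1 {x | x - t ∈ B} :=
  Measure.map_apply (by fun_prop) hB

theorem shift_lat_box (i j : Fin d → ℤ) (μ : LocFinMeasure d) :
    (shift (lat i) μ).1 (box j) = μ.1 (box (j + i)) := by
  rw [shift_apply_preimage _ _ (measurableSet_box _)]
  congr 1
  ext x
  have := add_lat_mem_box_iff (i := j + i) (j := i) (x := x - lat i)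
  simpa using this.symm

theorem shift_shift (s t : Vec d) (μ : LocFinMeasure d) :
    shift s (shift t μ) = shift (s + t) μ := by
  refine Subtype.ext ?_
  change (μ.1.map fun x => x - t).map (fun x => x - s) = μ.1.map fun x => x - (s + t)
  rw [Measure.map_map (by fun_prop) (by fun_prop)]
  congr 1
  ext1 x
  simp [sub_sub, add_comm]

theorem shift_zero (μ : LocFinMeasure d) : shift 0 μ = μ := by
  refine Subtype.ext ?_
  simp [shift]

theorem pairShift_pairShift (s t : Vec d) (z : E × LocFinMeasure d) :
    pairShift s (pairShift t z) = pairShift (s + t) z := by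
  simp [pairShift, shift_shift, add_vadd]

theorem pairShift_zero (z : E × LocFinMeasure d) : pairShift 0 z = z := by
  simp [pairShift, shift_zero]

theorem pairShift_neg_pairShift (t : Vec d) (z : E × LocFinMeasure d) :
    pairShift (-t) (pairShift t z) = z := by
  rw [pairShift_pairShift, neg_add_cancel, pairShift_zero]

theorem measurable_shift : Measurable fun p : Vec d × LocFinMeasure d => shift p.1 p.2 := by
  refine Measurable.subtype_mk (Measure.measurable_of_measurable_coe _ fun B hB => ?_)
  have h : ∀ p : Vec d × LocFinMeasure d, (p.2.1.map fun x => x - p.1) B =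
      ∫⁻ x, B.indicator 1 (x - p.1) ∂p.2.1 := by
    intro p
    rw [← lintegral_map (f := B.indicator 1) (measurable_one.indicator hB) (by fun_prop),
      lintegral_indicator_one hB]
  simp_rw [h]
  refine measurable_snd.lintegral_locFinMeasure ?_
  exact (measurable_one.indicator hB).comp (by fun_prop)

variable [MeasurableSpace E] [MeasurableVAdd₂ (Vec d) E]

theorem measurable_pairShift :
    Measurable fun p : Vec d × (E × LocFinMeasure d) => pairShift p.1 p.2 :=
  (measurable_fst.vadd measurable_snd.fst).prodMk
    (measurable_shift.comp (measurable_fst.prodMk measurable_snd.snd))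

theorem _root_.Measurable.pairShift {α : Type*} [MeasurableSpace α] {t : α → Vec d}
    {z : α → E × LocFinMeasure d} (ht : Measurable t) (hz : Measurable z) :
    Measurable fun a => pairShift (t a) (z a) :=
  measurable_pairShift.comp (ht.prodMk hz)

end RandomMeasure

namespace RandomMeasure

variable {d : ℕ} {E : Type*} [MeasurableSpace E]

/-- The random measure of a pair, as a kernel. -/
noncomputable def sndKernel (d : ℕ) (E : Type*) [MeasurableSpace E] :
    Kernel (E × LocFinMeasure d) (Vec d) :=
  (evalKernel d).comap Prod.snd measurable_snd

instance : IsSFiniteKernel (sndKernel d E) := by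
  unfold sndKernel; infer_instance

theorem sndKernel_apply (z : E × LocFinMeasure d) : sndKernel d E z = z.2.1 := rfl

variable [AddAction (Vec d) E]

/-! ### The Palm measure of a stationary measure -/

/-- Invariance of a measure on `E × LocFinMeasure d` under all joint shifts. -/
def IsShiftInvariant (M : Measure (E × LocFinMeasure d)) : Prop :=
  ∀ t : Vec d, M.map (pairShift t) = M

/-- The Palm measure of `M`, computed with the unit box. -/
noncomputable def palm (M : Measure (E × LocFinMeasure d)) : Measure (E × LocFinMeasure d) :=
  (M ⊗ₘ (sndKernel d E).restrict (measurableSet_box 0)).map fun p => pairShift p.2 p.1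

instance (M : Measure (E × LocFinMeasure d)) : SFinite (palm M) := by
  unfold palm; infer_instance

variable [MeasurableVAdd₂ (Vec d) E] {M : Measure (E × LocFinMeasure d)}

theorem IsShiftInvariant.lintegral_pairShift (hM : IsShiftInvariant M) (t : Vec d)
    {f : E × LocFinMeasure d → ℝ≥0∞} (hf : Measurable f) :
    ∫⁻ z, f (pairShift t z) ∂M = ∫⁻ z, f z ∂M := by
  conv_rhs => rw [← hM t]
  rw [lintegral_map (g := pairShift t) hf (measurable_const.pairShift measurable_id)]

theorem lintegral_palm [SFinite M] {f : E × LocFinMeasure d → ℝ≥0∞} (hf : Measurable f) :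
    ∫⁻ z, f z ∂palm M = ∫⁻ z, ∫⁻ t in box 0, f (pairShift t z) ∂z.2.1 ∂M := by
  have h : Measurable fun p : (E × LocFinMeasure d) × Vec d => pairShift p.2 p.1 :=
    measurable_snd.pairShift measurable_fst
  rw [palm, lintegral_map hf h, Measure.lintegral_compProd (f := fun p => f (pairShift p.2 p.1)) (hf.comp h)]
  rfl

/-! ### Campbell and exchange formulas -/

/-- For fixed `r`, replace `z` by `θ_r z`, which invariance allows: the point `t` of `z` is then
seen at `t - r`, while the picture centred at it is unchanged. Tonelli does the rest. -/
theorem lintegral_lintegral_shift (hM : IsShiftInvariant M) [SFinite M]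
    {h : Vec d → E × LocFinMeasure d → Vec d → ℝ≥0∞}
    (hh : Measurable fun p : Vec d × (E × LocFinMeasure d) × Vec d => h p.1 p.2.1 p.2.2) :
    ∫⁻ r, ∫⁻ z, ∫⁻ t, h r (pairShift t z) t ∂z.2.1 ∂M =
      ∫⁻ z, ∫⁻ t, ∫⁻ r, h r (pairShift t z) (t - r) ∂volume ∂z.2.1 ∂M := by
  have key : ∀ r : Vec d, ∫⁻ z, ∫⁻ t, h r (pairShift t z) t ∂z.2.1 ∂M =
      ∫⁻ z, ∫⁻ t, h r (pairShift t z) (t - r) ∂z.2.1 ∂M := by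
    intro r
    have hm : Measurable fun z : E × LocFinMeasure d => ∫⁻ t, h r (pairShift t z) t ∂z.2.1 := by
      refine measurable_snd.lintegral_locFinMeasure ?_
      exact hh.comp (measurable_const.prodMk
        ((measurable_snd.pairShift measurable_fst).prodMk measurable_snd))
    rw [← hM.lintegral_pairShift r hm]
    refine lintegral_congr fun z => ?_
    change ∫⁻ t, h r (pairShift t (pairShift r z)) t ∂(shift r z.2).1 = _
    rw [lintegral_shift]
    · simp [pairShift_pairShift]
    · exact hh.comp (measurable_const.prodMk
        ((measurable_id.pairShift measurable_const).prodMk measurable_id))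
  simp_rw [key]
  have h3 : Measurable fun p : (Vec d × (E × LocFinMeasure d)) × Vec d =>
      h p.1.1 (pairShift p.2 p.1.2) (p.2 - p.1.1) :=
    hh.comp (measurable_fst.fst.prodMk
      ((measurable_snd.pairShift measurable_fst.snd).prodMk (by fun_prop)))
  rw [lintegral_lintegral_swap]
  · refine lintegral_congr fun z => ?_
    rw [lintegral_lintegral_swap]
    refine Measurable.aemeasurable ?_
    exact h3.comp ((measurable_fst.prodMk measurable_const).prodMk measurable_snd)
  · refine Measurable.aemeasurable ?_
    exact (measurable_snd.comp measurable_snd).lintegral_locFinMeasure h3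

theorem lintegral_indicator_box_zero :
    ∫⁻ r : Vec d, (box 0).indicator 1 r = 1 := by
  rw [lintegral_indicator_one (measurableSet_box 0), volume_box_zero]

theorem measurable_indicator_box {α : Type*} [MeasurableSpace α] {f : α → Vec d}
    (hf : Measurable f) (i : Fin d → ℤ) :
    Measurable fun a => (box i).indicator (1 : Vec d → ℝ≥0∞) (f a) :=
  (measurable_one.indicator (measurableSet_box i)).comp hf

/-- The refined Campbell theorem. -/
theorem lintegral_campbell (hM : IsShiftInvariant M) [SFinite M]
    {g : E × LocFinMeasure d → Vec d → ℝ≥0∞} (hg : Measurable (Function.uncurry g)) :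
    ∫⁻ z, ∫⁻ t, g (pairShift t z) t ∂z.2.1 ∂M = ∫⁻ z, ∫⁻ r, g z r ∂volume ∂palm M := by
  -- The two instances exchange the roles of the auxiliary variable and of the point of the measure.
  -- After reflecting `r` to `t - r`, both lead to the same triple integral.
  have hl := lintegral_lintegral_shift hM (h := fun s z t => (box 0).indicator 1 s * g z t)
    ((measurable_indicator_box measurable_fst 0).mul (hg.comp measurable_snd))
  have hr := lintegral_lintegral_shift hM (h := fun r z t => (box 0).indicator 1 t * g z r)
    ((measurable_indicator_box measurable_snd.snd 0).mul
      (hg.comp (measurable_snd.fst.prodMk measurable_fst)))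
  have hgt : ∀ z, Measurable fun t => g (pairShift t z) t := fun z =>
    hg.comp ((measurable_id.pairShift measurable_const).prodMk measurable_id)
  have hm : Measurable fun p : (E × LocFinMeasure d) × Vec d => g (pairShift p.2 p.1) p.2 :=
    hg.comp ((measurable_snd.pairShift measurable_fst).prodMk measurable_snd)
  have hm3 : Measurable fun p : ((E × LocFinMeasure d) × Vec d) × Vec d =>
      (box 0).indicator (1 : Vec d → ℝ≥0∞) p.2 * g (pairShift p.2 p.1.1) p.1.2 :=
    (measurable_indicator_box measurable_snd 0).mul
      (hg.comp ((measurable_snd.pairShift measurable_fst.fst).prodMk measurable_fst.snd))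
  calc ∫⁻ z, ∫⁻ t, g (pairShift t z) t ∂z.2.1 ∂M
      = ∫⁻ s, ∫⁻ z, ∫⁻ t, (box 0).indicator 1 s * g (pairShift t z) t ∂z.2.1 ∂M := by
        have : ∀ s : Vec d, ∫⁻ z, ∫⁻ t, (box 0).indicator 1 s * g (pairShift t z) t ∂z.2.1 ∂M =
            (box 0).indicator 1 s * ∫⁻ z, ∫⁻ t, g (pairShift t z) t ∂z.2.1 ∂M := by
          intro s
          rw [← lintegral_const_mul _ (measurable_snd.lintegral_locFinMeasure hm)]
          exact lintegral_congr fun z => lintegral_const_mul _ (hgt z)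
        rw [lintegral_congr this, lintegral_mul_const _ (measurable_one.indicator (measurableSet_box 0)),
          lintegral_indicator_box_zero, one_mul]
    _ = ∫⁻ z, ∫⁻ t, ∫⁻ r, (box 0).indicator 1 (t - r) * g (pairShift t z) r ∂volume ∂z.2.1 ∂M := by
        rw [hl]
        refine lintegral_congr fun z => lintegral_congr fun t => ?_
        rw [← lintegral_sub_left_eq_self _ t]
        simp
    _ = ∫⁻ r, ∫⁻ z, ∫⁻ t, (box 0).indicator 1 t * g (pairShift t z) r ∂z.2.1 ∂M := hr.symm
    _ = ∫⁻ z, ∫⁻ r, g z r ∂volume ∂palm M := by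
        rw [lintegral_palm (f := fun z => ∫⁻ r, g z r) hg.lintegral_prod_right',
          lintegral_lintegral_swap]
        · refine lintegral_congr fun z => ?_
          rw [lintegral_lintegral_swap, ← lintegral_indicator (measurableSet_box 0)]
          · refine lintegral_congr fun t => ?_
            by_cases ht : t ∈ box 0 <;> simp [ht]
          · exact (hm3.comp ((measurable_const.prodMk measurable_fst).prodMk
              measurable_snd)).aemeasurable
        · refine Measurable.aemeasurable ?_
          exact (measurable_snd.comp measurable_snd).lintegral_locFinMeasure
            (hm3.comp ((measurable_fst.snd.prodMk measurable_fst.fst).prodMk measurable_snd))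

/-- The Palm measure does not depend on the set used to compute it. -/
theorem lintegral_palm_mul_volume (hM : IsShiftInvariant M) [SFinite M]
    {f : E × LocFinMeasure d → ℝ≥0∞} (hf : Measurable f) {B : Set (Vec d)}
    (hB : MeasurableSet B) :
    (∫⁻ z, f z ∂palm M) * volume B = ∫⁻ z, ∫⁻ t in B, f (pairShift t z) ∂z.2.1 ∂M := by
  have hg : Measurable (Function.uncurry fun z t => f z * B.indicator (1 : Vec d → ℝ≥0∞) t) :=
    (hf.comp measurable_fst).mul ((measurable_one.indicator hB).comp measurable_snd)
  have h := lintegral_campbell hM hg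
  have h1 : ∀ z, ∫⁻ r, f z * B.indicator (1 : Vec d → ℝ≥0∞) r = f z * volume B := fun z => by
    rw [lintegral_const_mul _ (measurable_one.indicator hB), lintegral_indicator_one hB]
  simp_rw [h1] at h
  rw [← lintegral_mul_const _ hf, ← h]
  refine lintegral_congr fun z => ?_
  rw [← lintegral_indicator hB]
  refine lintegral_congr fun t => ?_
  by_cases ht : t ∈ B <;> simp [ht]

/-- Mecke's exchange formula for the Palm measure. -/
theorem lintegral_palm_exchange (hM : IsShiftInvariant M) [SFinite M]
    {g : E × LocFinMeasure d → Vec d → ℝ≥0∞} (hg : Measurable (Function.uncurry g)) :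
    ∫⁻ z, ∫⁻ v, g (pairShift v z) (-v) ∂z.2.1 ∂palm M =
      ∫⁻ z, ∫⁻ v, g z v ∂z.2.1 ∂palm M := by
  have hg1 : Measurable fun p : (E × LocFinMeasure d) × Vec d => g (pairShift p.2 p.1) (-p.2) :=
    hg.comp ((measurable_snd.pairShift measurable_fst).prodMk measurable_snd.neg)
  have hg2 : Measurable fun p : ((E × LocFinMeasure d) × Vec d) × Vec d =>
      (box 0).indicator (1 : Vec d → ℝ≥0∞) (p.2 + p.1.2) * g p.1.1 p.2 :=
    (measurable_indicator_box (measurable_snd.add measurable_fst.snd) 0).mul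
      (hg.comp (measurable_fst.fst.prodMk measurable_snd))
  -- A pair of points `t`, `s` with `t` in the box is re-read from `s`, so that `t = v + s`.
  -- Campbell then replaces `s` by a Lebesgue variable, and the box indicator integrates to one.
  have hC := lintegral_campbell hM
    (g := fun z s => ∫⁻ v, (box 0).indicator 1 (v + s) * g z v ∂z.2.1)
    (measurable_fst.snd.lintegral_locFinMeasure hg2)
  rw [lintegral_palm (measurable_snd.lintegral_locFinMeasure hg1)]
  calc ∫⁻ z, ∫⁻ t in box 0, ∫⁻ v, g (pairShift v (pairShift t z)) (-v)
        ∂(pairShift t z).2.1 ∂z.2.1 ∂M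
      = ∫⁻ z, ∫⁻ s, ∫⁻ v, (box 0).indicator 1 (v + s) * g (pairShift s z) v
          ∂(pairShift s z).2.1 ∂z.2.1 ∂M := by
        refine lintegral_congr fun z => ?_
        have h1 : ∀ t : Vec d, ∫⁻ v, g (pairShift v (pairShift t z)) (-v) ∂(pairShift t z).2.1 =
            ∫⁻ s, g (pairShift s z) (t - s) ∂z.2.1 := by
          intro t
          change ∫⁻ v, g (pairShift v (pairShift t z)) (-v) ∂(shift t z.2).1 = _
          rw [lintegral_shift]
          · simp [pairShift_pairShift]
          · exact hg1.comp ((measurable_const (a := pairShift t z)).prodMk measurable_id)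
        have h2 : ∀ s : Vec d, ∫⁻ v, (box 0).indicator 1 (v + s) * g (pairShift s z) v
            ∂(pairShift s z).2.1 =
            ∫⁻ t, (box 0).indicator 1 t * g (pairShift s z) (t - s) ∂z.2.1 := by
          intro s
          change ∫⁻ v, (box 0).indicator 1 (v + s) * g (pairShift s z) v ∂(shift s z.2).1 = _
          rw [lintegral_shift]
          · simp only [sub_add_cancel]
          · exact (measurable_indicator_box (measurable_id.add_const s) 0).mul
              (hg.comp ((measurable_const (a := pairShift s z)).prodMk measurable_id))
        rw [lintegral_congr h2, setLIntegral_congr_fun (measurableSet_box 0) fun t _ => h1 t,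
          lintegral_lintegral_swap]
        · refine lintegral_congr fun s => ?_
          rw [← lintegral_indicator (measurableSet_box 0)]
          refine lintegral_congr fun t => ?_
          by_cases ht : t ∈ box 0 <;> simp [ht]
        · refine Measurable.aemeasurable ?_
          exact hg.comp ((measurable_snd.pairShift measurable_const).prodMk
            (measurable_fst.sub measurable_snd))
    _ = ∫⁻ z, ∫⁻ v, g z v ∂z.2.1 ∂palm M := by
        rw [hC]
        refine lintegral_congr fun z => ?_
        rw [lintegral_lintegral_swap]
        · refine lintegral_congr fun v => ?_
          rw [lintegral_mul_const _ (measurable_indicator_box (by fun_prop) 0),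
            lintegral_add_left_eq_self (fun s => (box 0).indicator (1 : Vec d → ℝ≥0∞) s) v,
            lintegral_indicator_box_zero, one_mul]
        · exact (hg2.comp ((measurable_const.prodMk measurable_fst).prodMk
            measurable_snd)).aemeasurable

end RandomMeasure

namespace RandomMeasure

/-! ### σ-finiteness of the Palm measure -/

/-- The measure with density `f` is finite, and the density `1/f`, finite everywhere, brings `μ`
back. -/
theorem sigmaFinite_of_lintegral_ne_top {α : Type*} [MeasurableSpace α] {μ : Measure α}
    {f : α → ℝ≥0∞} (hf : Measurable f) (hpos : ∀ x, f x ≠ 0) (hfin : ∫⁻ x, f x ∂μ ≠ ∞) :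
    SigmaFinite μ := by
  have h := withDensity_inv_same hf (.of_forall hpos) (ae_lt_top hf hfin |>.mono fun _ h => h.ne)
  have : IsFiniteMeasure (μ.withDensity f) := isFiniteMeasure_withDensity hfin
  rw [← h]
  exact SigmaFinite.withDensity_of_ne_top (.of_forall fun x => by simpa using hpos x)

/-- A positive function of `μ` and `t` whose integral against `μ` is at most one. -/
theorem exists_measurable_pos_lintegral_le_one (d : ℕ) :
    ∃ k : LocFinMeasure d × Vec d → ℝ≥0∞, Measurable k ∧ (∀ p, k p ≠ 0) ∧
      ∀ μ : LocFinMeasure d, ∫⁻ t, k (μ, t) ∂μ.1 ≤ 1 := by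
  obtain ⟨w, hw, hw1⟩ := ENNReal.exists_pos_sum_of_countable' one_ne_zero (Fin d → ℤ)
  -- The inverse of one plus the box mass keeps the contribution of box `i` below the summable
  -- weight `w i`, and it does not vanish since box masses are finite.
  let f : (Fin d → ℤ) → LocFinMeasure d × Vec d → ℝ≥0∞ := fun i p =>
    w i * (1 + p.1.1 (box i))⁻¹ * (box i).indicator 1 p.2
  have hf : ∀ i, Measurable (f i) := fun i =>
    (measurable_const.mul (measurable_const.add
      ((measurable_eval (measurableSet_box i)).comp measurable_fst)).inv).mul
      (measurable_indicator_box measurable_snd i)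
  refine ⟨fun p => ∑' i, f i p, Measurable.tsum hf, fun p h => ?_, fun μ => ?_⟩
  · have h0 := ENNReal.tsum_eq_zero.1 h fun k => ⌊p.2 k⌋
    have hb : p.2 ∈ box fun k => ⌊p.2 k⌋ := mem_box_iff_floor.2 rfl
    have hfin := (measure_box_lt_top p.1 fun k => ⌊p.2 k⌋).ne
    simp [f, hb, (hw _).ne', hfin] at h0
  · have hfμ : ∀ i, AEMeasurable (fun t => f i (μ, t)) μ.1 := fun i =>
      ((hf i).comp measurable_prodMk_left).aemeasurable
    rw [lintegral_tsum hfμ]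
    refine (ENNReal.tsum_le_tsum fun i => ?_).trans hw1.le
    have hbox : ∫⁻ t, (box i).indicator (1 : Vec d → ℝ≥0∞) t ∂μ.1 = μ.1 (box i) :=
      lintegral_indicator_one (measurableSet_box i)
    simp only [f]
    rw [lintegral_const_mul _ (measurable_one.indicator (measurableSet_box i)), hbox, mul_assoc]
    refine mul_le_of_le_one_right' ?_
    rw [mul_comm, ← div_eq_mul_inv]
    exact ENNReal.div_le_of_le_mul (by rw [one_mul]; exact le_add_self)

variable {d : ℕ} {E : Type*} [MeasurableSpace E] [AddAction (Vec d) E]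
  [MeasurableVAdd₂ (Vec d) E] {M : Measure (E × LocFinMeasure d)}

/-- Campbell's formula carries a positive integrand back to `M` once the shift is undone inside it.
There `h` is integrable, and `k` integrates to at most one against each measure. -/
theorem IsShiftInvariant.sigmaFinite_palm (hM : IsShiftInvariant M) [SigmaFinite M] :
    SigmaFinite (palm M) := by
  obtain ⟨h, hpos, hmeas, hlt⟩ := exists_pos_lintegral_lt_of_sigmaFinite M one_ne_zero
  obtain ⟨k, hk, hk0, hk1⟩ := exists_measurable_pos_lintegral_le_one d
  let g : E × LocFinMeasure d → Vec d → ℝ≥0∞ := fun z r =>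
    h (pairShift (-r) z) * k ((pairShift (-r) z).2, r)
  have hps : Measurable fun p : (E × LocFinMeasure d) × Vec d => pairShift (-p.2) p.1 :=
    measurable_snd.neg.pairShift measurable_fst
  have hg : Measurable (Function.uncurry g) :=
    (hmeas.comp hps).coe_nnreal_ennreal.mul (hk.comp (hps.snd.prodMk measurable_snd))
  refine sigmaFinite_of_lintegral_ne_top (f := fun z => ∫⁻ r, g z r) hg.lintegral_prod_right'
    (fun z => ?_) ?_
  · refine ((lintegral_pos_iff_support (hg.comp measurable_prodMk_left)).2 ?_).ne'
    have : Function.support (Function.uncurry g ∘ Prod.mk z) = Set.univ := by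
      ext r
      simp [g, (hpos _).ne', hk0]
    rw [this]
    exact Measure.measure_univ_pos.2 (NeZero.ne _)
  · rw [← lintegral_campbell hM hg]
    refine ((lintegral_mono fun z => ?_).trans_lt (hlt.trans ENNReal.one_lt_top)).ne
    simp only [g, pairShift_neg_pairShift]
    rw [lintegral_const_mul (f := fun t => k (z.2, t)) _ (hk.comp measurable_prodMk_left)]
    exact mul_le_of_le_one_right' (hk1 z.2)

/-! ### The support at the origin -/

/-- Countably many balls suffice, which makes membership in the support a measurable event. -/
theorem mem_support_iff_forall_ball (μ : Measure (Vec d)) (x : Vec d) :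
    x ∈ μ.support ↔ ∀ n : ℕ, 0 < μ (Metric.ball x (1 / (n + 1))) := by
  simpa using Metric.nhds_basis_ball_inv_nat_succ.mem_measureSupport (x := x) (μ := μ)

theorem zero_mem_support_shift_iff (t : Vec d) (μ : LocFinMeasure d) :
    0 ∈ (shift t μ).1.support ↔ t ∈ μ.1.support := by
  simp only [mem_support_iff_forall_ball, shift_apply_preimage _ _ Metric.isOpen_ball.measurableSet]
  simp [Metric.ball, dist_eq_norm]

theorem measurableSet_zero_mem_support :
    MeasurableSet {μ : LocFinMeasure d | (0 : Vec d) ∈ μ.1.support} := by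
  simp only [mem_support_iff_forall_ball]
  rw [Set.ofPred_forall]
  exact MeasurableSet.iInter fun n =>
    measurableSet_lt measurable_const (measurable_eval Metric.isOpen_ball.measurableSet)

/-- The Palm measure moves a point chosen by the random measure to the origin, and almost every such
point lies in the support. -/
theorem ae_palm_zero_mem_support [SFinite M] :
    ∀ᵐ z ∂palm M, (0 : Vec d) ∈ z.2.1.support := by
  have hps : Measurable fun p : (E × LocFinMeasure d) × Vec d => pairShift p.2 p.1 :=
    measurable_snd.pairShift measurable_fst
  have hs : MeasurableSet {z : E × LocFinMeasure d | (0 : Vec d) ∈ z.2.1.support} :=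
    measurable_snd measurableSet_zero_mem_support
  rw [palm, ae_map_iff hps.aemeasurable hs]
  refine Measure.ae_compProd_of_ae_ae (hps hs) ?_
  refine .of_forall fun z => ?_
  rw [Kernel.restrict_apply, sndKernel_apply]
  refine ae_restrict_of_ae ?_
  filter_upwards [Measure.support_mem_ae (μ := z.2.1)] with t ht
  exact (zero_mem_support_shift_iff t z.2).2 ht

end RandomMeasure

namespace RandomMeasure

variable {d : ℕ}

/-! ### The conditional distribution on a translated window -/

/-- The mass of the window `C - u`. -/
noncomputable def windowMass (C : Set (Vec d)) (μ : LocFinMeasure d) (u : Vec d) : ℝ≥0∞ :=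
  μ.1 {v | v + u ∈ C}

theorem measurableSet_window {C : Set (Vec d)} (hC : MeasurableSet C) (u : Vec d) :
    MeasurableSet {v | v + u ∈ C} :=
  hC.preimage (measurable_id.add_const u)

theorem windowMass_eq_lintegral {C : Set (Vec d)} (hC : MeasurableSet C) (μ : LocFinMeasure d)
    (u : Vec d) : windowMass C μ u = ∫⁻ v, C.indicator 1 (v + u) ∂μ.1 :=
  (lintegral_indicator_one (measurableSet_window hC u)).symm

theorem measurable_windowMass {C : Set (Vec d)} (hC : MeasurableSet C) :
    Measurable fun p : LocFinMeasure d × Vec d => windowMass C p.1 p.2 := by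
  simp_rw [windowMass_eq_lintegral hC]
  exact measurable_fst.lintegral_locFinMeasure
    ((measurable_one.indicator hC).comp (measurable_snd.add measurable_fst.snd))

/-- The window is the same set seen from the new origin `v`. Hence the denominator of the
conditional law survives the change of origin. -/
theorem windowMass_shift {C : Set (Vec d)} (hC : MeasurableSet C) (μ : LocFinMeasure d)
    (u v : Vec d) : windowMass C (shift v μ) u = windowMass C μ (u - v) := by
  rw [windowMass, shift_apply_preimage _ _ (measurableSet_window hC u), windowMass]
  congr 1
  ext x
  simp only [Set.mem_ofPred_eq]
  rw [sub_add_eq_add_sub, add_sub_assoc]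

theorem windowMass_lt_top {C : Set (Vec d)} (hC : Bornology.IsBounded C) (μ : LocFinMeasure d)
    (u : Vec d) : windowMass C μ u < ∞ := by
  refine Bornology.IsBounded.measure_lt_top ?_
  exact (isometry_add_right u).antilipschitz.isBounded_preimage hC

/-- For `u` interior to `C`, the window `C - u` is a neighbourhood of the origin. -/
theorem windowMass_pos {C : Set (Vec d)} {μ : LocFinMeasure d} (h0 : (0 : Vec d) ∈ μ.1.support)
    {u : Vec d} (hu : u ∈ interior C) : 0 < windowMass C μ u := by
  refine (Measure.mem_support_iff_forall 0).1 h0 _ ?_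
  have hc : Continuous fun v : Vec d => v + u := by fun_prop
  exact hc.continuousAt.preimage_mem_nhds (by simpa using mem_interior_iff_mem_nhds.1 hu)

open Classical in
/-- The conditional distribution of a random measure on the window `C - u`, as a Markov kernel. -/
noncomputable def windowKernel {C : Set (Vec d)} (hC : MeasurableSet C) :
    Kernel (LocFinMeasure d × Vec d) (Vec d) where
  -- The default value makes the kernel Markov everywhere. For the windows used below, it is met
  -- only on a null set.
  toFun p := if 0 < windowMass C p.1 p.2 ∧ windowMass C p.1 p.2 < ∞ then
    cond p.1.1 {v | v + p.2 ∈ C} else Measure.dirac 0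
  measurable' := by
    have hm := measurable_windowMass hC
    refine Measurable.ite ((measurableSet_lt measurable_const hm).inter
      (measurableSet_lt hm measurable_const)) ?_ measurable_const
    refine Measure.measurable_of_measurable_coe _ fun B hB => ?_
    have h : ∀ p : LocFinMeasure d × Vec d, cond p.1.1 {v | v + p.2 ∈ C} B =
        (windowMass C p.1 p.2)⁻¹ * ∫⁻ v in B, C.indicator 1 (v + p.2) ∂p.1.1 := by
      intro p
      rw [cond_apply (measurableSet_window hC _), windowMass,
        ← lintegral_indicator_one (measurableSet_window hC p.2 |>.inter hB), Set.inter_comm,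
        ← lintegral_indicator hB]
      congr 1
      refine lintegral_congr fun v => ?_
      by_cases h1 : v ∈ B <;> by_cases h2 : v + p.2 ∈ C <;> simp [h1, h2]
    simp_rw [h]
    exact hm.inv.mul (measurable_fst.setLIntegral_locFinMeasure
      (f := fun p v => C.indicator 1 (v + p.2)) ((measurable_one.indicator hC).comp (measurable_snd.add measurable_fst.snd)) hB)

theorem windowKernel_apply {C : Set (Vec d)} (hC : MeasurableSet C) {p : LocFinMeasure d × Vec d}
    (h0 : 0 < windowMass C p.1 p.2) (h1 : windowMass C p.1 p.2 < ∞) :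
    windowKernel hC p = cond p.1.1 {v | v + p.2 ∈ C} :=
  if_pos ⟨h0, h1⟩

instance {C : Set (Vec d)} (hC : MeasurableSet C) : IsMarkovKernel (windowKernel hC) := by
  classical
  refine ⟨fun p => ?_⟩
  by_cases h : 0 < windowMass C p.1 p.2 ∧ windowMass C p.1 p.2 < ∞
  · rw [windowKernel_apply hC h.1 h.2]
    exact cond_isProbabilityMeasure_of_finite h.1.ne' h.2.ne
  · have : windowKernel hC p = Measure.dirac 0 := if_neg h
    rw [this]
    infer_instance

theorem lintegral_windowKernel {C : Set (Vec d)} (hC : MeasurableSet C)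
    {p : LocFinMeasure d × Vec d} (h0 : 0 < windowMass C p.1 p.2)
    (h1 : windowMass C p.1 p.2 < ∞) (f : Vec d → ℝ≥0∞) :
    ∫⁻ v, f v ∂windowKernel hC p =
      (windowMass C p.1 p.2)⁻¹ * ∫⁻ v, C.indicator 1 (v + p.2) * f v ∂p.1.1 := by
  rw [windowKernel_apply hC h0 h1, ProbabilityTheory.cond, lintegral_smul_measure,
    ← lintegral_indicator (measurableSet_window hC _), smul_eq_mul, windowMass]
  congr 1
  refine lintegral_congr fun v => ?_
  by_cases h2 : v + p.2 ∈ C <;> simp [h2]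

/-! ### Mass-stationarity of the Palm measure -/

variable {E : Type*} [MeasurableSpace E] [AddAction (Vec d) E]
  [MeasurableVAdd₂ (Vec d) E] {M : Measure (E × LocFinMeasure d)}

/-- Here the null boundary enters: it rules out windows that touch the origin only at their edge and
might carry no mass. -/
theorem ae_cond_mem_interior {C : Set (Vec d)} (hC : MeasurableSet C)
    (hfr : volume (frontier C) = 0) : ∀ᵐ u ∂cond volume C, u ∈ interior C := by
  have hfr' : ∀ᵐ u ∂cond volume C, u ∉ frontier C :=
    
    cond_absolutelyContinuous.ae_le (measure_eq_zero_iff_ae_notMem.1 hfr)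
  filter_upwards [hfr', ae_cond_mem hC] with u h1 h2
  by_contra h
  exact h1 ⟨subset_closure h2, h⟩

theorem ae_prod_windowMass_pos [SFinite M] {C : Set (Vec d)} (hC : MeasurableSet C)
    (hfr : volume (frontier C) = 0) :
    ∀ᵐ p ∂(palm M).prod (cond volume C), 0 < windowMass C p.1.2 p.2 := by
  have hm : Measurable fun p : (E × LocFinMeasure d) × Vec d => windowMass C p.1.2 p.2 :=
    (measurable_windowMass hC).comp (measurable_fst.snd.prodMk measurable_snd)
  rw [Measure.ae_prod_iff_ae_ae (measurableSet_lt measurable_const hm)]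
  filter_upwards [ae_palm_zero_mem_support (M := M)] with z hz
  filter_upwards [ae_cond_mem_interior hC hfr] with u hu
  exact windowMass_pos hz hu

/-- With `w = v + u`, the jump from `u` to `w` has weight `1_C(u) 1_C(w)` over the window mass, and
this mass is common to both ends. Exchanging the ends and integrating over the jump gives back the
window mass, which cancels. -/
theorem lintegral_window_exchange (hM : IsShiftInvariant M) [SFinite M] {C : Set (Vec d)}
    (hC : MeasurableSet C) (hCb : Bornology.IsBounded C) (hfr : volume (frontier C) = 0)
    {g : E × LocFinMeasure d → Vec d → ℝ≥0∞} (hg : Measurable (Function.uncurry g)) :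
    ∫⁻ z, ∫⁻ u in C, (windowMass C z.2 u)⁻¹ *
        ∫⁻ v, C.indicator 1 (v + u) * g (pairShift v z) (v + u) ∂z.2.1 ∂volume ∂palm M =
      ∫⁻ z, ∫⁻ u in C, g z u ∂volume ∂palm M := by
  have hone : Measurable (C.indicator (1 : Vec d → ℝ≥0∞)) := measurable_one.indicator hC
  have hmass : Measurable fun p : (E × LocFinMeasure d) × Vec d => windowMass C p.1.2 p.2 :=
    (measurable_windowMass hC).comp (measurable_fst.snd.prodMk measurable_snd)
  -- The integrand as seen from the point reached by the jump: `w` is the new position in `C`, `v`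
  -- leads back to the old origin, and `w + v` is the old position.
  let G : (E × LocFinMeasure d) → Vec d → Vec d → ℝ≥0∞ := fun z v w =>
    C.indicator 1 (w + v) * ((windowMass C z.2 w)⁻¹ * (C.indicator 1 w * g z w))
  have hG : Measurable fun p : ((E × LocFinMeasure d) × Vec d) × Vec d => G p.1.1 p.1.2 p.2 :=
    (hone.comp (measurable_snd.add measurable_fst.snd)).mul
      ((hmass.comp (measurable_fst.fst.prodMk measurable_snd)).inv.mul
        ((hone.comp measurable_snd).mul (hg.comp (measurable_fst.fst.prodMk measurable_snd))))
  have hGshift : ∀ z (v w : Vec d), G (pairShift v z) (-v) w = C.indicator 1 (w - v) *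
      ((windowMass C z.2 (w - v))⁻¹ * (C.indicator 1 w * g (pairShift v z) w)) := by
    intro z v w
    simp only [G, ← sub_eq_add_neg]
    rw [show (pairShift v z).2 = shift v z.2 from rfl, windowMass_shift hC]
  have hmG : Measurable (Function.uncurry fun z v => ∫⁻ w, G z v w) :=
    hG.lintegral_prod_right'
  have hmecke := lintegral_palm_exchange hM hmG
  have hleft : ∀ z : E × LocFinMeasure d, ∫⁻ u in C, (windowMass C z.2 u)⁻¹ *
        ∫⁻ v, C.indicator 1 (v + u) * g (pairShift v z) (v + u) ∂z.2.1 ∂volume =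
      ∫⁻ v, ∫⁻ w, G (pairShift v z) (-v) w ∂volume ∂z.2.1 := by
    intro z
    have hgz : Measurable fun p : Vec d × Vec d => g (pairShift p.2 z) (p.2 + p.1) :=
      hg.comp ((measurable_snd.pairShift measurable_const).prodMk
        (measurable_snd.add measurable_fst))
    have hmz : Measurable fun u : Vec d => windowMass C z.2 u :=
      hmass.comp (measurable_const.prodMk measurable_id)
    have hF : Measurable fun p : Vec d × Vec d => C.indicator (1 : Vec d → ℝ≥0∞) p.1 *
        ((windowMass C z.2 p.1)⁻¹ *
          (C.indicator 1 (p.2 + p.1) * g (pairShift p.2 z) (p.2 + p.1))) :=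
      (hone.comp measurable_fst).mul ((hmz.comp measurable_fst).inv.mul
        ((hone.comp (measurable_snd.add measurable_fst)).mul hgz))
    calc ∫⁻ u in C, (windowMass C z.2 u)⁻¹ *
          ∫⁻ v, C.indicator 1 (v + u) * g (pairShift v z) (v + u) ∂z.2.1 ∂volume
        = ∫⁻ u, ∫⁻ v, C.indicator (1 : Vec d → ℝ≥0∞) u * ((windowMass C z.2 u)⁻¹ *
            (C.indicator 1 (v + u) * g (pairShift v z) (v + u))) ∂z.2.1 ∂volume := by
          rw [← lintegral_indicator hC]
          refine lintegral_congr fun u => ?_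
          have hinner : Measurable fun v => C.indicator (1 : Vec d → ℝ≥0∞) (v + u) *
              g (pairShift v z) (v + u) :=
            (hone.comp (measurable_id.add_const u)).mul
              (hgz.comp ((measurable_const (a := u)).prodMk measurable_id))
          rw [lintegral_const_mul _ (hinner.const_mul _), lintegral_const_mul _ hinner]
          by_cases hu : u ∈ C <;> simp [hu]
      _ = ∫⁻ v, ∫⁻ u, C.indicator (1 : Vec d → ℝ≥0∞) u * ((windowMass C z.2 u)⁻¹ *
            (C.indicator 1 (v + u) * g (pairShift v z) (v + u))) ∂volume ∂z.2.1 :=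
          lintegral_lintegral_swap hF.aemeasurable
      _ = ∫⁻ v, ∫⁻ w, G (pairShift v z) (-v) w ∂volume ∂z.2.1 := by
          refine lintegral_congr fun v => ?_
          rw [← lintegral_add_left_eq_self (fun w => G (pairShift v z) (-v) w) v]
          simp only [hGshift, add_sub_cancel_left]
  rw [lintegral_congr hleft, hmecke]
  refine lintegral_congr_ae ?_
  filter_upwards [ae_palm_zero_mem_support (M := M)] with z hz
  have hfr' : ∀ᵐ w : Vec d, w ∉ frontier C := measure_eq_zero_iff_ae_notMem.1 hfr
  have hswap := lintegral_lintegral_swap (μ := z.2.1) (ν := volume) (f := fun v w => G z v w)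
    (hG.comp (((measurable_const (a := z)).prodMk measurable_fst).prodMk
      measurable_snd)).aemeasurable
  rw [hswap, ← lintegral_indicator hC]
  refine lintegral_congr_ae ?_
  filter_upwards [hfr'] with w hw
  simp only [G]
  have hw' : Measurable fun v : Vec d => C.indicator (1 : Vec d → ℝ≥0∞) (w + v) :=
    hone.comp (measurable_id.const_add w)
  rw [lintegral_mul_const _ hw']
  by_cases hwC : w ∈ C
  · have hint : w ∈ interior C := by
      by_contra h
      exact hw ⟨subset_closure hwC, h⟩
    have hm : ∫⁻ v, C.indicator (1 : Vec d → ℝ≥0∞) (w + v) ∂z.2.1 = windowMass C z.2 w := by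
      simp_rw [windowMass_eq_lintegral hC, add_comm]
    rw [hm, ← mul_assoc, ENNReal.mul_inv_cancel (windowMass_pos hz hint).ne'
      (windowMass_lt_top hCb z.2 w).ne]
    simp [hwC]
  · simp [hwC]

/-- Any random pair distributed according to the Palm measure is mass-stationary. -/
theorem isMassStationary_of_map_eq_palm (hM : IsShiftInvariant M) [SigmaFinite M] {Ω : Type*}
    [MeasurableSpace Ω] {P : Measure Ω} {Z : Ω → E × LocFinMeasure d} (hZ : AEMeasurable Z P)
    (hPZ : P.map Z = palm M) : IsMassStationary P Z := by
  refine ⟨hPZ ▸ hM.sigmaFinite_palm, ?_, fun C hC hCb hC0 hfr => ?_⟩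
  · refine ae_of_ae_map (p := fun z => (0 : Vec d) ∈ z.2.1.support) hZ ?_
    rw [hPZ]
    exact ae_palm_zero_mem_support
  rw [hPZ]
  have hCtop : volume C ≠ ∞ := hCb.measure_lt_top.ne
  have : IsProbabilityMeasure (cond volume C) := cond_isProbabilityMeasure_of_finite hC0.ne' hCtop
  let κ : Kernel ((E × LocFinMeasure d) × Vec d) (Vec d) :=
    (windowKernel hC).comap (fun p => (p.1.2, p.2)) (measurable_fst.snd.prodMk measurable_snd)
  -- The law of `U` does not depend on the pair, so the first two coordinates form a product; the
  -- window kernel then supplies `V`.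
  let ρ := (palm M).prod (cond volume C)
  let W : Measure ((E × LocFinMeasure d) × Vec d × Vec d) :=
    (ρ ⊗ₘ κ).map MeasurableEquiv.prodAssoc
  have hW : ∀ {β : Type _} [MeasurableSpace β] {f : (E × LocFinMeasure d) × Vec d × Vec d → β},
      Measurable f → W.map f = (ρ ⊗ₘ κ).map fun p => f (p.1.1, p.1.2, p.2) := fun hf =>
    Measure.map_map hf MeasurableEquiv.prodAssoc.measurable
  have hW12 : W.map (fun w => (w.1, w.2.1)) = ρ := by
    rw [hW (by fun_prop)]
    exact Measure.fst_compProd ρ κ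
  have hW1 : W.map (fun w => w.1) = palm M := by
    calc W.map (fun w => w.1) = (W.map fun w => (w.1, w.2.1)).map Prod.fst :=
          (Measure.map_map measurable_fst (measurable_fst.prodMk measurable_snd.fst)).symm
      _ = palm M := by rw [hW12]; exact Measure.fst_prod
  refine ⟨W, hW1, ⟨Kernel.const _ (cond volume C), inferInstance, ⟨by fun_prop, ?_⟩,
    .of_forall fun _ => rfl⟩, ⟨κ, inferInstance, ⟨by fun_prop, ?_⟩, ?_⟩, ?_⟩
  · rw [hW12, hW1, Measure.compProd_const]
  · rw [hW12, hW (by fun_prop)]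
    exact Measure.map_id
  · have h : ∀ᵐ p ∂W.map fun w => (w.1, w.2.1), 0 < windowMass C p.1.2 p.2 := by
      rw [hW12]
      exact ae_prod_windowMass_pos hC hfr
    filter_upwards [ae_of_ae_map (by fun_prop) h] with w hw
    exact windowKernel_apply hC (p := (w.1.2, w.2.1)) hw (windowMass_lt_top hCb _ _)
  · rw [hW12]
    have hps : Measurable fun p : ((E × LocFinMeasure d) × Vec d) × Vec d =>
        (pairShift p.2 p.1.1, p.2 + p.1.2) :=
      (measurable_snd.pairShift measurable_fst.fst).prodMk (measurable_snd.add measurable_fst.snd)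
    have hps' : Measurable fun w : (E × LocFinMeasure d) × Vec d × Vec d =>
        (pairShift w.2.2 w.1, w.2.2 + w.2.1) :=
      (measurable_snd.snd.pairShift measurable_fst).prodMk
        (measurable_snd.snd.add measurable_snd.fst)
    rw [hW hps']
    refine Measure.ext_of_lintegral _ fun g hg => ?_
    rw [lintegral_map hg hps, Measure.lintegral_compProd
      (f := fun p : ((E × LocFinMeasure d) × Vec d) × Vec d =>
        g (pairShift p.2 p.1.1, p.2 + p.1.2)) (hg.comp hps)]
    have hmass : Measurable fun p : (E × LocFinMeasure d) × Vec d => windowMass C p.1.2 p.2 :=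
      (measurable_windowMass hC).comp (measurable_fst.snd.prodMk measurable_snd)
    have hinner : Measurable fun p : (E × LocFinMeasure d) × Vec d =>
        ∫⁻ v, C.indicator 1 (v + p.2) * g (pairShift v p.1, v + p.2) ∂p.1.2.1 :=
      (measurable_fst.snd).lintegral_locFinMeasure (((measurable_one.indicator hC).comp
        (measurable_snd.add measurable_fst.snd)).mul (hg.comp hps))
    have hstep : ∫⁻ p, ∫⁻ v, g (pairShift v p.1, v + p.2) ∂κ p ∂ρ =
        ∫⁻ p, (windowMass C p.1.2 p.2)⁻¹ *
          ∫⁻ v, C.indicator 1 (v + p.2) * g (pairShift v p.1, v + p.2) ∂p.1.2.1 ∂ρ := by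
      refine lintegral_congr_ae ?_
      filter_upwards [ae_prod_windowMass_pos (M := M) hC hfr] with p hp
      exact lintegral_windowKernel hC (p := (p.1.2, p.2)) hp (windowMass_lt_top hCb _ _) _
    have hcond : ∀ f : Vec d → ℝ≥0∞, ∫⁻ u, f u ∂cond volume C =
        (volume C)⁻¹ * ∫⁻ u in C, f u := fun f => by
      rw [ProbabilityTheory.cond, lintegral_smul_measure, smul_eq_mul]
    have hmul : Measurable fun p : (E × LocFinMeasure d) × Vec d => (windowMass C p.1.2 p.2)⁻¹ *
        ∫⁻ v, C.indicator 1 (v + p.2) * g (pairShift v p.1, v + p.2) ∂p.1.2.1 :=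
      hmass.inv.mul hinner
    refine hstep.trans ((lintegral_prod _ hmul.aemeasurable).trans
      (Eq.trans ?_ (lintegral_prod _ hg.aemeasurable).symm))
    simp_rw [hcond]
    rw [lintegral_const_mul' _ _ (ENNReal.inv_ne_top.2 hC0.ne'),
      lintegral_const_mul' _ _ (ENNReal.inv_ne_top.2 hC0.ne')]
    congr 1
    exact lintegral_window_exchange hM hC hCb hfr (g := fun z u => g (z, u)) hg

end RandomMeasure

namespace RandomMeasure

variable {d : ℕ}

/-! ### Nearest lattice points -/

theorem lat_add (i j : Fin d → ℤ) : lat (i + j) = lat i + lat j := by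
  ext k; simp [lat]

theorem lat_neg (i : Fin d → ℤ) : lat (-i) = -lat i := by
  ext k; simp [lat]

theorem lat_sub (i j : Fin d → ℤ) : lat (i - j) = lat i - lat j := by
  ext k; simp [lat]

theorem abs_sub_le_norm_lat (i j : Fin d → ℤ) (k : Fin d) :
    |((i k - j k : ℤ) : ℝ)| ≤ ‖lat i - lat j‖ := by
  simpa [lat] using PiLp.norm_apply_le (lat i - lat j) k

theorem finite_setOf_norm_lat_sub_le (p : Fin d → ℤ) (r : ℝ) :
    {i : Fin d → ℤ | ‖lat i - lat p‖ ≤ r}.Finite := by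
  refine (Set.finite_Icc (fun k => p k - ⌈r⌉) fun k => p k + ⌈r⌉).subset fun i hi => ?_
  have h : ∀ k, |i k - p k| ≤ ⌈r⌉ := fun k => by
    have h1 := ((abs_sub_le_norm_lat i p k).trans hi).trans (Int.le_ceil r)
    exact_mod_cast h1
  exact ⟨fun k => by have := abs_le.1 (h k); simp only; omega,
    fun k => by have := abs_le.1 (h k); simp only; omega⟩

/-- One point of `N` confines the search to a finite ball, where the lexicographic order on
(distance, point) has a minimum. -/
theorem exists_isNearest {μ : LocFinMeasure d} (h : (latticePoints μ).Nonempty)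
    (i : Fin d → ℤ) : ∃ p, IsNearest μ i p := by
  obtain ⟨p₀, hp₀⟩ := h
  let A : Set (Fin d → ℤ) := latticePoints μ ∩ {q | ‖lat q - lat i‖ ≤ ‖lat p₀ - lat i‖}
  have hA : A.Finite := (finite_setOf_norm_lat_sub_le i _).subset Set.inter_subset_right
  obtain ⟨p, hpA, hp⟩ := Set.exists_min_image A
    (fun q => toLex (dist (lat i) (lat q), toLex q)) hA
    ⟨p₀, hp₀, le_refl ‖lat p₀ - lat i‖⟩
  refine ⟨p, hpA.1, fun q hq => ?_⟩
  by_cases hqA : q ∈ A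
  · exact Prod.Lex.le_iff.1 (hp q hqA)
  · refine .inl ?_
    have h1 : ‖lat p₀ - lat i‖ < ‖lat q - lat i‖ := not_le.1 fun h => hqA ⟨hq, h⟩
    rw [dist_eq_norm', dist_eq_norm']
    exact lt_of_le_of_lt hpA.2 h1

theorem IsNearest.unique {μ : LocFinMeasure d} {i p q : Fin d → ℤ} (hp : IsNearest μ i p)
    (hq : IsNearest μ i q) : p = q := by
  rcases hp.2 q hq.1 with h | ⟨h, h'⟩ <;> rcases hq.2 p hp.1 with k | ⟨k, k'⟩
  · exact absurd h k.not_gt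
  · exact absurd k h.ne'
  · exact absurd h k.ne'
  · exact toLex.injective (le_antisymm h' k')

theorem IsNearest.nearest_eq {μ : LocFinMeasure d} {i p : Fin d → ℤ} (hp : IsNearest μ i p) :
    nearest μ i = p := by
  have h : ∃ p, IsNearest μ i p := ⟨p, hp⟩
  rw [nearest, dif_pos h]
  exact h.choose_spec.unique hp

theorem isNearest_nearest {μ : LocFinMeasure d} (h : (latticePoints μ).Nonempty)
    (i : Fin d → ℤ) : IsNearest μ i (nearest μ i) := by
  obtain ⟨p, hp⟩ := exists_isNearest h i
  rwa [hp.nearest_eq]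

theorem nearest_eq_self {μ : LocFinMeasure d} {p : Fin d → ℤ} (hp : p ∈ latticePoints μ) :
    nearest μ p = p := by
  refine IsNearest.nearest_eq ⟨hp, fun q _ => ?_⟩
  rcases eq_or_ne p q with rfl | hne
  · exact .inr ⟨rfl, le_rfl⟩
  · refine .inl ?_
    rw [dist_self, dist_pos]
    intro h
    refine hne (funext fun k => ?_)
    have hk : ((p k : ℤ) : ℝ) = q k := congrArg (fun x : Vec d => x k) h
    exact_mod_cast hk

theorem mem_latticePoints_shift {i j : Fin d → ℤ} {μ : LocFinMeasure d} :
    j ∈ latticePoints (shift (lat i) μ) ↔ j + i ∈ latticePoints μ := by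
  simp only [latticePoints, Set.mem_ofPred_eq, shift_lat_box]

theorem toLex_add_le_toLex_add_iff (i p q : Fin d → ℤ) :
    toLex (p + i) ≤ toLex (q + i) ↔ toLex p ≤ toLex q := by
  simp only [toLex_add, add_le_add_iff_right]

/-- Distances and the lexicographic order are both translation invariant, so the tie-breaking rule
commutes with lattice shifts, as the mass transport requires. -/
theorem isNearest_shift {i j p : Fin d → ℤ} {μ : LocFinMeasure d} :
    IsNearest (shift (lat i) μ) j p ↔ IsNearest μ (j + i) (p + i) := by
  simp only [IsNearest, mem_latticePoints_shift]
  refine and_congr_right fun _ => ⟨fun h q hq => ?_, fun h q hq => ?_⟩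
  · have := h (q - i) (by simpa using hq)
    rw [← toLex_add_le_toLex_add_iff i] at this
    simpa [lat_add, lat_sub, dist_eq_norm, sub_sub_eq_add_sub, add_sub_add_right_eq_sub] using this
  · have := h (q + i) hq
    rw [toLex_add_le_toLex_add_iff i] at this
    simpa [lat_add] using this

/-- The convention for empty `N` is also equivariant, so no nonemptiness is needed. -/
theorem nearest_shift (i j : Fin d → ℤ) (μ : LocFinMeasure d) :
    nearest (shift (lat i) μ) j = nearest μ (j + i) - i := by
  by_cases h : ∃ p, IsNearest (shift (lat i) μ) j p
  · obtain ⟨p, hp⟩ := h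
    rw [hp.nearest_eq, (isNearest_shift.1 hp).nearest_eq, add_sub_cancel_right]
  · have h' : ¬∃ p, IsNearest μ (j + i) p := fun ⟨p, hp⟩ =>
      h ⟨p - i, isNearest_shift.2 (by rwa [sub_add_cancel])⟩
    rw [nearest, dif_neg h, nearest, dif_neg h', add_sub_cancel_right]

/-- The distance and order comparisons are deterministic; the measure enters only through countably
many membership events. -/
theorem measurableSet_isNearest (i p : Fin d → ℤ) :
    MeasurableSet {μ : LocFinMeasure d | IsNearest μ i p} := by
  have hN : ∀ q, MeasurableSet {μ : LocFinMeasure d | q ∈ latticePoints μ} := fun q =>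
    measurableSet_lt measurable_const (measurable_eval (measurableSet_box q))
  simp only [IsNearest, imp_iff_not_or, Set.ofPred_and, Set.ofPred_forall]
  exact (hN p).inter (MeasurableSet.iInter fun q => (hN q).compl.union (MeasurableSet.const _))

theorem measurable_nearest (i : Fin d → ℤ) :
    Measurable fun μ : LocFinMeasure d => nearest μ i := by
  refine measurable_to_countable' fun p => ?_
  have : (fun μ : LocFinMeasure d => nearest μ i) ⁻¹' {p} = {μ | IsNearest μ i p} ∪
      ((⋂ q, {μ | IsNearest μ i q}ᶜ) ∩ {_μ | i = p}) := by
    ext μ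
    simp only [Set.mem_preimage, Set.mem_singleton_iff, Set.mem_union, Set.mem_inter_iff,
      Set.mem_iInter, Set.mem_compl_iff, Set.mem_ofPred_eq]
    by_cases h : ∃ q, IsNearest μ i q
    · obtain ⟨q, hq⟩ := h
      rw [hq.nearest_eq]
      refine ⟨fun h => .inl (h ▸ hq), ?_⟩
      rintro (h | ⟨h, -⟩)
      · exact hq.unique h
      · exact absurd hq (h q)
    · rw [nearest, dif_neg h]
      rw [not_exists] at h
      simp [h]
  rw [this]
  exact (measurableSet_isNearest i p).union ((MeasurableSet.iInter fun q =>
    (measurableSet_isNearest i q).compl).inter (MeasurableSet.const _))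

/-! ### Cells -/

theorem mem_cell {μ : LocFinMeasure d} {i j : Fin d → ℤ} :
    j ∈ cell μ i ↔ nearest μ j = nearest μ i := Iff.rfl

theorem self_mem_cell (μ : LocFinMeasure d) (i : Fin d → ℤ) : i ∈ cell μ i := rfl

theorem measurableSet_mem_cell (i j : Fin d → ℤ) :
    MeasurableSet {μ : LocFinMeasure d | j ∈ cell μ i} :=
  measurableSet_eq_fun (measurable_nearest j) (measurable_nearest i)

theorem encard_cell_eq_tsum (μ : LocFinMeasure d) (i : Fin d → ℤ) :
    ((cell μ i).encard : ℝ≥0∞) = ∑' j, (cell μ i).indicator 1 j := by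
  rw [← ENNReal.tsum_set_one, tsum_subtype (cell μ i) (fun _ => (1 : ℝ≥0∞))]
  rfl

theorem measurable_indicator_cell (i j : Fin d → ℤ) :
    Measurable fun μ : LocFinMeasure d => (cell μ i).indicator (1 : (Fin d → ℤ) → ℝ≥0∞) j := by
  have : (fun μ : LocFinMeasure d => (cell μ i).indicator (1 : (Fin d → ℤ) → ℝ≥0∞) j) =
      {μ : LocFinMeasure d | j ∈ cell μ i}.indicator 1 := by
    ext μ
    by_cases h : j ∈ cell μ i <;> simp [h]
  rw [this]
  exact measurable_one.indicator (measurableSet_mem_cell i j)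

theorem measurable_encard_cell (i : Fin d → ℤ) :
    Measurable fun μ : LocFinMeasure d => ((cell μ i).encard : ℝ≥0∞) := by
  simp_rw [encard_cell_eq_tsum]
  exact Measurable.tsum fun j => measurable_indicator_cell i j

theorem encard_cell_ne_top_iff {μ : LocFinMeasure d} {i : Fin d → ℤ} :
    ((cell μ i).encard : ℝ≥0∞) ≠ ∞ ↔ (cell μ i).Finite := by
  simp [Set.encard_eq_top_iff]

theorem cell_shift (i j : Fin d → ℤ) (μ : LocFinMeasure d) :
    cell (shift (lat i) μ) j = (fun k => k + i) ⁻¹' cell μ (j + i) := by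
  ext k
  simp [mem_cell, nearest_shift]

theorem encard_cell_shift (i j : Fin d → ℤ) (μ : LocFinMeasure d) :
    (cell (shift (lat i) μ) j).encard = (cell μ (j + i)).encard := by
  rw [cell_shift]
  exact Set.encard_preimage_of_bijective (Equiv.addRight i).bijective _

/-! ### Finiteness of the cells -/

theorem latticePoints_nonempty {μ : LocFinMeasure d}
    (h : convexHull ℝ μ.1.support = Set.univ) : (latticePoints μ).Nonempty := by
  have hne : μ.1.support.Nonempty := by
    rw [← convexHull_nonempty_iff (𝕜 := ℝ), h]
    exact Set.univ_nonempty
  by_contra hN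
  have hz : ∀ i : Fin d → ℤ, μ.1 (box i) = 0 := fun i =>
    not_not.1 fun hi => hN ⟨i, pos_iff_ne_zero.2 hi⟩
  refine (Measure.nonempty_support_iff.1 hne) ?_
  rw [← Measure.measure_univ_eq_zero, ← iUnion_box]
  exact measure_iUnion_null hz

/-- If all lattice points lie in a half-space, then so does the support. -/
theorem support_subset_halfSpace {μ : LocFinMeasure d} {u : Vec d} (hu : ‖u‖ = 1) {c : ℝ}
    (h : ∀ q ∈ latticePoints μ, inner ℝ u (lat q) ≤ c) :
    ∃ c', μ.1.support ⊆ {x | inner ℝ u x ≤ c'} := by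
  obtain ⟨R, hR⟩ := (isBounded_box (d := d) 0).exists_norm_le
  -- `R` bounds the distance from a point of a box to its corner, and 1 is the radius of the ball
  -- around `x` that must meet a charged box.
  refine ⟨c + R + 1, fun x hx => ?_⟩
  have hpos : 0 < μ.1 (Metric.ball x 1) :=
    (Measure.mem_support_iff_forall x).1 hx _ (Metric.ball_mem_nhds x one_pos)
  obtain ⟨q, hq⟩ : ∃ q : Fin d → ℤ, μ.1 (Metric.ball x 1 ∩ box q) ≠ 0 := by
    by_contra! hcon
    refine hpos.ne' ?_
    rw [← Set.inter_univ (Metric.ball x 1), ← iUnion_box, Set.inter_iUnion]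
    exact measure_iUnion_null hcon
  obtain ⟨y, hyx, hyq⟩ := nonempty_of_measure_ne_zero hq
  have hqN : q ∈ latticePoints μ :=
    (pos_iff_ne_zero.2 hq).trans_le (measure_mono Set.inter_subset_right)
  have h1 : ‖y - lat q‖ ≤ R := hR _ (by
    have := add_lat_mem_box_iff (i := q) (j := q) (x := y - lat q)
    simpa [hyq] using this)
  have h2 : ‖x - y‖ ≤ 1 := by
    rw [← dist_eq_norm, dist_comm]
    exact (Metric.mem_ball.1 hyx).le
  have h3 := real_inner_le_norm u (y - lat q)
  have h4 := real_inner_le_norm u (x - y)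
  have h5 : inner ℝ u x = inner ℝ u (lat q) + inner ℝ u (y - lat q) + inner ℝ u (x - y) := by
    rw [← inner_add_right, ← inner_add_right]
    congr 1
    abel
  have h6 := h q hqN
  rw [hu, one_mul] at h3 h4
  simp only [Set.mem_ofPred_eq]
  linarith

/-- The cells are finite as soon as the support is contained in no half-space. -/
theorem finite_cell {μ : LocFinMeasure d} (h : convexHull ℝ μ.1.support = Set.univ)
    (i : Fin d → ℤ) : (cell μ i).Finite := by
  by_contra hinf
  have hN := latticePoints_nonempty h
  set p := nearest μ i with hp
  have hex : ∀ n : ℕ, ∃ j ∈ cell μ i, (n : ℝ) + 1 < ‖lat j - lat p‖ := by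
    intro n
    by_contra! hcon
    exact hinf ((finite_setOf_norm_lat_sub_le p (n + 1)).subset hcon)
  choose j hj hjn using hex
  -- Since `j n` is no farther from `p` than from `q`, it lies on the `p` side of their bisector. A
  -- factor one half is given away.
  have hle : ∀ n, ∀ q ∈ latticePoints μ,
      inner ℝ (lat (j n) - lat p) (lat q - lat p) ≤ ‖lat q - lat p‖ ^ 2 := by
    intro n q hq
    have hnear : IsNearest μ (j n) p := by
      rw [hp, ← mem_cell.1 (hj n)]
      exact isNearest_nearest hN _
    have hd : dist (lat (j n)) (lat p) ≤ dist (lat (j n)) (lat q) := by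
      rcases hnear.2 q hq with h | h
      · exact h.le
      · exact h.1.le
    rw [dist_eq_norm, dist_eq_norm] at hd
    have h1 := norm_sub_sq_real (lat (j n) - lat p) (lat q - lat p)
    rw [sub_sub_sub_cancel_right] at h1
    have h2 := pow_le_pow_left₀ (norm_nonneg _) hd 2
    have h3 : 0 ≤ ‖lat q - lat p‖ ^ 2 := by positivity
    nlinarith
  let r : ℕ → ℝ := fun n => ‖lat (j n) - lat p‖
  let v : ℕ → Vec d := fun n => (r n)⁻¹ • (lat (j n) - lat p)
  have hr : ∀ n, 0 < r n := fun n => lt_trans (by positivity) (hjn n)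
  have hv : ∀ n, v n ∈ Metric.sphere (0 : Vec d) 1 := by
    intro n
    rw [mem_sphere_zero_iff_norm, norm_smul, norm_inv, norm_norm]
    exact inv_mul_cancel₀ (hr n).ne'
  obtain ⟨u, hu, φ, hφ, hlim⟩ := (isCompact_sphere (0 : Vec d) 1).tendsto_subseq hv
  rw [mem_sphere_zero_iff_norm] at hu
  have hr_lim : Filter.Tendsto (fun n => (r (φ n))⁻¹) Filter.atTop (nhds 0) := by
    refine Filter.Tendsto.inv_tendsto_atTop ?_
    have hr_top : Filter.Tendsto r Filter.atTop Filter.atTop :=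
      Filter.tendsto_atTop_mono (fun n => (lt_trans (lt_add_one _) (hjn n)).le)
        tendsto_natCast_atTop_atTop
    exact hr_top.comp hφ.tendsto_atTop
  -- Dividing the bisector inequality by the diverging norm `r` kills its right side in the limit.
  have hhalf : ∀ q ∈ latticePoints μ, inner ℝ u (lat q) ≤ inner ℝ u (lat p) := by
    intro q hq
    rw [← sub_nonpos, ← inner_sub_right]
    have h1 : Filter.Tendsto (fun n => inner ℝ (v (φ n)) (lat q - lat p)) Filter.atTop
        (nhds (inner ℝ u (lat q - lat p))) := hlim.inner tendsto_const_nhds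
    have h2 := hr_lim.mul_const (‖lat q - lat p‖ ^ 2)
    rw [zero_mul] at h2
    refine le_of_tendsto_of_tendsto' h1 h2 fun n => ?_
    simp only [v]
    rw [real_inner_smul_left]
    exact mul_le_mul_of_nonneg_left (hle _ q hq) (inv_nonneg.2 (hr _).le)
  obtain ⟨c, hc⟩ := support_subset_halfSpace hu hhalf
  have hconv : Convex ℝ {x : Vec d | inner ℝ u x ≤ c} :=
    convex_halfSpace_le (innerₗ (Vec d) u).isLinear c
  have hall := convexHull_min hc hconv
  rw [h] at hall
  have hmem : inner ℝ u ((c + 1) • u) ≤ c := hall (Set.mem_univ _)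
  rw [real_inner_smul_right, real_inner_self_eq_norm_sq, hu] at hmem
  linarith

end RandomMeasure

namespace RandomMeasure

variable {d : ℕ}

/-! ### The uniform distribution on the cell of the origin -/

theorem lintegral_uniformOn {α : Type*} [MeasurableSpace α] [DiscreteMeasurableSpace α]
    (s : Set α) (f : α → ℝ≥0∞) :
    ∫⁻ x, f x ∂uniformOn s = (s.encard : ℝ≥0∞)⁻¹ * ∑' x, s.indicator 1 x * f x := by
  rw [uniformOn, ProbabilityTheory.cond, lintegral_smul_measure, smul_eq_mul,
    Measure.count_apply (MeasurableSet.of_discrete (s := s)), ← lintegral_indicator (MeasurableSet.of_discrete (s := s)),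
    lintegral_count]
  congr 1
  refine tsum_congr fun x => ?_
  by_cases hx : x ∈ s <;> simp [hx]

theorem measurableSet_finite_cell : MeasurableSet {μ : LocFinMeasure d | (cell μ 0).Finite} := by
  simp_rw [← encard_cell_ne_top_iff]
  exact (measurable_encard_cell 0 (measurableSet_singleton ∞)).compl

open Classical in
/-- The uniform distribution on the cell of the origin, as a Markov kernel. -/
noncomputable def cellKernel (d : ℕ) : Kernel (LocFinMeasure d) (Fin d → ℤ) where
  toFun μ := if (cell μ 0).Finite then uniformOn (cell μ 0) else Measure.dirac 0
  measurable' := by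
    refine Measurable.ite measurableSet_finite_cell ?_ measurable_const
    refine Measure.measurable_of_measurable_coe _ fun B hB => ?_
    simp_rw [← lintegral_indicator_one hB, lintegral_uniformOn]
    exact (measurable_encard_cell 0).inv.mul
      (Measurable.tsum fun j => (measurable_indicator_cell 0 j).mul_const _)

theorem cellKernel_apply {μ : LocFinMeasure d} (h : (cell μ 0).Finite) :
    cellKernel d μ = uniformOn (cell μ 0) := if_pos h

instance : IsMarkovKernel (cellKernel d) := by
  classical
  refine ⟨fun μ => ?_⟩
  by_cases h : (cell μ 0).Finite
  · rw [cellKernel_apply h]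
    exact isProbabilityMeasure_uniformOn h ⟨0, self_mem_cell μ 0⟩
  · have : cellKernel d μ = Measure.dirac 0 := if_neg h
    rw [this]
    infer_instance

/-- The centred cell is the cell of the origin in the recentred picture. -/
theorem cell_shift_offset {μ : LocFinMeasure d} (h : (latticePoints μ).Nonempty) :
    cell (shift (-lat (offset μ 0)) μ) 0 = centredCell μ := by
  have hp : nearest μ (nearest μ 0) = nearest μ 0 := nearest_eq_self (isNearest_nearest h 0).1
  rw [centredCell, offset, ← lat_neg, cell_shift, zero_sub, neg_neg, zero_add,
    Set.image_add_left, neg_neg]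
  ext j
  simp [mem_cell, hp, add_comm]

/-! ### Recentring a stationary measure at its lattice point -/

variable {E : Type*} [MeasurableSpace E] [AddAction (Vec d) E]
  [MeasurableVAdd₂ (Vec d) E]

/-- Mass transport: the origin looks for its point of `N` on the left, while on the right the origin
is itself such a point and all sites of its cell are summed. -/
theorem lintegral_recentre {M : Measure (E × LocFinMeasure d)} (hM : IsShiftInvariant M)
    (hN : ∀ᵐ z ∂M, (latticePoints z.2).Nonempty) (hfin : ∀ᵐ z ∂M, (cell z.2 0).Finite)
    {g : E × LocFinMeasure d → Vec d → (Fin d → ℤ) → ℝ≥0∞}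
    (hg : Measurable fun p : (E × LocFinMeasure d) × Vec d × (Fin d → ℤ) =>
      g p.1 p.2.1 p.2.2) :
    ∫⁻ z, ((cell z.2 0).encard : ℝ≥0∞)⁻¹ *
        ∫⁻ t in box 0, g (pairShift t (pairShift (lat (nearest z.2 0)) z)) t (-nearest z.2 0)
          ∂(shift (lat (nearest z.2 0)) z.2).1 ∂M =
      ∫⁻ z, ∫⁻ t in box 0, ∫⁻ j, g (pairShift t z) t j ∂cellKernel d z.2 ∂z.2.1 ∂M := by
  classical
  have hgj : ∀ j, Measurable fun p : (E × LocFinMeasure d) × Vec d =>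
      g (pairShift p.2 p.1) p.2 j := fun j =>
    hg.comp ((measurable_snd.pairShift measurable_fst).prodMk
      (measurable_snd.prodMk measurable_const))
  -- `Φ j` is the contribution of site `j` when it is served by the origin. The left integrand is
  -- the single nonzero term of `∑ i, Φ (-i) (θ_i z)`, and invariance removes each `θ_i`.
  let Φ : (Fin d → ℤ) → E × LocFinMeasure d → ℝ≥0∞ := fun j z =>
    if nearest z.2 j = 0 then ((cell z.2 j).encard : ℝ≥0∞)⁻¹ *
      ∫⁻ t in box 0, g (pairShift t z) t j ∂z.2.1 else 0
  have hΦ : ∀ j, Measurable (Φ j) := fun j =>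
    Measurable.ite (((measurable_nearest j).comp measurable_snd) (measurableSet_singleton 0))
      (((measurable_encard_cell j).comp measurable_snd).inv.mul
        (measurable_snd.setLIntegral_locFinMeasure (hgj j) (measurableSet_box 0)))
      measurable_const
  have hleft : ∀ z : E × LocFinMeasure d, ((cell z.2 0).encard : ℝ≥0∞)⁻¹ *
        ∫⁻ t in box 0, g (pairShift t (pairShift (lat (nearest z.2 0)) z)) t (-nearest z.2 0)
          ∂(shift (lat (nearest z.2 0)) z.2).1 = ∑' i, Φ (-i) (pairShift (lat i) z) := by
    intro z
    have hs : ∀ i, (pairShift (lat i) z).2 = shift (lat i) z.2 := fun _ => rfl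
    rw [tsum_eq_single (nearest z.2 0)]
    · simp only [Φ, hs, nearest_shift, encard_cell_shift, neg_add_cancel, sub_self, if_true]
    · intro i hi
      simp only [Φ, hs, nearest_shift, neg_add_cancel, sub_eq_zero, hi.symm, if_false]
  have hΦi : ∀ i, ∫⁻ z, Φ (-i) (pairShift (lat i) z) ∂M = ∫⁻ z, Φ (-i) z ∂M := fun i =>
    hM.lintegral_pairShift (lat i) (hΦ (-i))
  have hΦs : ∀ i, AEMeasurable (fun z => Φ (-i) (pairShift (lat i) z)) M := fun i =>
    ((hΦ (-i)).comp (measurable_const.pairShift measurable_id)).aemeasurable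
  have hneg : ∑' i, ∫⁻ z, Φ (-i) z ∂M = ∑' j, ∫⁻ z, Φ j z ∂M :=
    (Equiv.neg (Fin d → ℤ)).tsum_eq fun j => ∫⁻ z, Φ j z ∂M
  rw [lintegral_congr hleft, lintegral_tsum hΦs, tsum_congr hΦi,
    hneg,
    ← lintegral_tsum fun j => (hΦ j).aemeasurable]
  refine lintegral_congr_ae ?_
  filter_upwards [hN, hfin] with z hzN hzfin
  by_cases h0 : (0 : Fin d → ℤ) ∈ latticePoints z.2
  · have hn0 : nearest z.2 0 = 0 := nearest_eq_self h0
    have hΦz : ∀ j, Φ j z = ((cell z.2 0).encard : ℝ≥0∞)⁻¹ * ((cell z.2 0).indicator 1 j *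
        ∫⁻ t in box 0, g (pairShift t z) t j ∂z.2.1) := by
      intro j
      by_cases hj : nearest z.2 j = 0
      · have hjc : j ∈ cell z.2 0 := by rw [mem_cell, hj, hn0]
        have hc : cell z.2 j = cell z.2 0 := by
          ext k
          rw [mem_cell, mem_cell, hj, hn0]
        simp [Φ, hj, hjc, hc]
      · have hjc : j ∉ cell z.2 0 := by rwa [mem_cell, hn0]
        simp [Φ, hj, hjc]
    have hgz : ∀ j, Measurable fun t => (cell z.2 0).indicator (1 : (Fin d → ℤ) → ℝ≥0∞) j *
        g (pairShift t z) t j := fun j =>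
      ((hgj j).comp (measurable_const.prodMk measurable_id)).const_mul _
    rw [tsum_congr hΦz, ENNReal.tsum_mul_left]
    simp_rw [cellKernel_apply hzfin, lintegral_uniformOn]
    rw [lintegral_const_mul _ (Measurable.tsum hgz), lintegral_tsum fun j => (hgz j).aemeasurable]
    congr 1
    refine tsum_congr fun j => ?_
    exact (lintegral_const_mul _ ((hgj j).comp (measurable_const.prodMk measurable_id))).symm
  -- If the origin is not in `N`, both sides vanish: its box has no mass and it serves no site.
  · have hbox : z.2.1 (box 0) = 0 := not_not.1 fun h => h0 (pos_iff_ne_zero.2 h)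
    rw [Measure.restrict_eq_zero.2 hbox, lintegral_zero_measure]
    refine ENNReal.tsum_eq_zero.2 fun j => if_neg fun hj => h0 ?_
    rw [← hj]
    exact (isNearest_nearest hzN j).1

theorem measurable_offset_zero : Measurable fun μ : LocFinMeasure d => offset μ 0 :=
  measurable_const.sub (measurable_nearest 0)

theorem measurableSet_latticePoints_nonempty :
    MeasurableSet {μ : LocFinMeasure d | (latticePoints μ).Nonempty} := by
  simp only [Set.Nonempty, Set.ofPred_exists]
  exact MeasurableSet.iUnion fun q =>
    measurableSet_lt measurable_const (measurable_eval (measurableSet_box q))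

/-- The joint law of the recentred pair, of `T` and of `S`. -/
theorem lintegral_recentred_law {Ω : Type*} [MeasurableSpace Ω] {P : Measure Ω}
    {Z : Ω → E × LocFinMeasure d} (hZ : Measurable Z) [SigmaFinite (P.map Z)]
    (hM : IsShiftInvariant (P.map Z))
    (hconv : ∀ᵐ ω ∂P, convexHull ℝ (Z ω).2.1.support = Set.univ)
    {T : Ω → Vec d} (hT : Measurable T)
    (hTcond : CondLawIs P T Z fun ω =>
      cond (shift (-lat (offset (Z ω).2 0)) (Z ω).2).1 (box (0 : Fin d → ℤ)))
    {g : E × LocFinMeasure d → Vec d → (Fin d → ℤ) → ℝ≥0∞}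
    (hg : Measurable fun p : (E × LocFinMeasure d) × Vec d × (Fin d → ℤ) =>
      g p.1 p.2.1 p.2.2) :
    ∫⁻ ω, g (pairShift (T ω) (pairShift (-lat (offset (Z ω).2 0)) (Z ω))) (T ω)
        (offset (Z ω).2 0) ∂(P.withDensity fun ω =>
          (shift (-lat (offset (Z ω).2 0)) (Z ω).2).1 (box (0 : Fin d → ℤ)) /
            ((cell (Z ω).2 0).encard : ℝ≥0∞)) =
      ∫⁻ z, ∫⁻ t in box 0, ∫⁻ j, g (pairShift t z) t j ∂cellKernel d z.2 ∂z.2.1 ∂P.map Z := by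
  have hN : ∀ᵐ ω ∂P, (latticePoints (Z ω).2).Nonempty := hconv.mono fun _ h =>
    latticePoints_nonempty h
  have hfin : ∀ᵐ ω ∂P, (cell (Z ω).2 0).Finite := hconv.mono fun _ h => finite_cell h 0
  rw [← lintegral_recentre hM
    ((ae_map_iff hZ.aemeasurable (measurable_snd measurableSet_latticePoints_nonempty)).2 hN)
    ((ae_map_iff hZ.aemeasurable (measurable_snd measurableSet_finite_cell)).2 hfin) hg]
  obtain ⟨K, hK, hKlaw, hKeq⟩ := hTcond
  have hlat : Measurable (lat : (Fin d → ℤ) → Vec d) := Measurable.of_discrete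
  have hoff : Measurable fun z : E × LocFinMeasure d => offset z.2 0 :=
    measurable_offset_zero.comp measurable_snd
  have hsh : Measurable fun z : E × LocFinMeasure d => pairShift (-lat (offset z.2 0)) z :=
    (hlat.comp hoff).neg.pairShift measurable_id
  let w : E × LocFinMeasure d → ℝ≥0∞ := fun z =>
    (shift (-lat (offset z.2 0)) z.2).1 (box (0 : Fin d → ℤ)) / ((cell z.2 0).encard : ℝ≥0∞)
  have hw : Measurable w :=
    ((measurable_eval (measurableSet_box 0)).comp hsh.snd).div
      ((measurable_encard_cell 0).comp measurable_snd)
  have hgs : Measurable fun p : (E × LocFinMeasure d) × Vec d =>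
      g (pairShift p.2 (pairShift (-lat (offset p.1.2 0)) p.1)) p.2 (offset p.1.2 0) :=
    hg.comp ((measurable_snd.pairShift (hsh.comp measurable_fst)).prodMk
      (measurable_snd.prodMk (hoff.comp measurable_fst)))
  let H : (E × LocFinMeasure d) × Vec d → ℝ≥0∞ := fun p => w p.1 *
    g (pairShift p.2 (pairShift (-lat (offset p.1.2 0)) p.1)) p.2 (offset p.1.2 0)
  have hH : Measurable H := (hw.comp measurable_fst).mul hgs
  have hneg : ∀ μ : LocFinMeasure d, -lat (offset μ 0) = lat (nearest μ 0) := fun μ => by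
    rw [← lat_neg, offset, zero_sub, neg_neg]
  have hJ : Measurable fun z : E × LocFinMeasure d => ((cell z.2 0).encard : ℝ≥0∞)⁻¹ *
      ∫⁻ t in box 0, g (pairShift t (pairShift (lat (nearest z.2 0)) z)) t (-nearest z.2 0)
        ∂(shift (lat (nearest z.2 0)) z.2).1 := by
    simp only [hneg] at hsh hgs
    simp only [offset, zero_sub] at hgs
    exact ((measurable_encard_cell 0).comp measurable_snd).inv.mul
      (hsh.snd.setLIntegral_locFinMeasure (f := fun z t =>
        g (pairShift t (pairShift (lat (nearest z.2 0)) z)) t (-nearest z.2 0)) hgs (measurableSet_box 0))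
  calc _ = ∫⁻ ω, H (Z ω, T ω) ∂P :=
        lintegral_withDensity_eq_lintegral_mul _ (hw.comp hZ) (hgs.comp (hZ.prodMk hT))
    _ = ∫⁻ z, ∫⁻ t, H (z, t) ∂K z ∂P.map Z := by
        rw [← Measure.lintegral_compProd hH, ← hKlaw.map_eq, lintegral_map hH (hZ.prodMk hT)]
    _ = ∫⁻ ω, ∫⁻ t, H (Z ω, t) ∂K (Z ω) ∂P := lintegral_map hH.lintegral_kernel_prod_right' hZ
    _ = _ := by
        rw [lintegral_map hJ hZ]
        refine lintegral_congr_ae ?_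
        filter_upwards [hKeq, hN] with ω hω hNω
        rw [hω]
        have hgω : Measurable fun t => g (pairShift t (pairShift (-lat (offset (Z ω).2 0)) (Z ω))) t
            (offset (Z ω).2 0) := hgs.comp ((measurable_const (a := Z ω)).prodMk measurable_id)
        have hpos : (shift (-lat (offset (Z ω).2 0)) (Z ω).2).1 (box (0 : Fin d → ℤ)) ≠ 0 := by
          rw [hneg, shift_lat_box, zero_add]
          exact (isNearest_nearest hNω 0).1.ne'
        have hlt := measure_box_lt_top (shift (-lat (offset (Z ω).2 0)) (Z ω).2) 0
        -- The box mass in the density of `P°` cancels the normalisation of the law of `T`; only the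
        -- division by the cell size remains.
        simp only [H, w]
        rw [lintegral_const_mul _ hgω, ProbabilityTheory.cond, lintegral_smul_measure, smul_eq_mul,
          div_eq_mul_inv, mul_mul_mul_comm, ENNReal.mul_inv_cancel hpos hlt.ne, one_mul, hneg]
        simp only [offset, zero_sub]

end RandomMeasure

/-! ### Reading off the conclusions from the joint law -/

theorem theorem2 {d : ℕ} {Ω E : Type*} [MeasurableSpace Ω] [MeasurableSpace E]
    [AddAction (Vec d) E] [MeasurableVAdd₂ (Vec d) E]
    (P : Measure Ω) (X : Ω → E) (ξ : Ω → LocFinMeasure d) (S : Ω → (Fin d → ℤ)) (T : Ω → Vec d)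
    (X₀ : Ω → E) (ξ₀ : Ω → LocFinMeasure d) (P₀ : Measure Ω)
    (hX : Measurable X) (hξ : Measurable ξ)
    (hσ : SigmaFinite (P.map fun ω => (X ω, ξ ω)))
    (hstat : IsStationary P fun ω => (X ω, ξ ω))
    (hconv : ∀ᵐ ω ∂P, convexHull ℝ (ξ ω).1.support = Set.univ)
    (hS : ∀ ω, S ω = offset (ξ ω) 0)
    (hT : Measurable T) (hTbox : ∀ ω, T ω ∈ box (0 : Fin d → ℤ))
    (hTcond : CondLawIs P T (fun ω => (X ω, ξ ω))
      fun ω => cond (shift (-lat (S ω)) (ξ ω)).1 (box (0 : Fin d → ℤ)))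
    (hZ₀ : ∀ ω, (X₀ ω, ξ₀ ω) = pairShift (T ω) (pairShift (-lat (S ω)) (X ω, ξ ω)))
    (hP₀ : P₀ = P.withDensity fun ω =>
      (shift (-lat (S ω)) (ξ ω)).1 (box (0 : Fin d → ℤ)) / ((cell (ξ ω) 0).encard : ℝ≥0∞)) :
    (∀ᵐ ω ∂P, (cell (ξ ω) 0).Finite) ∧
    IsMassStationary P₀ (fun ω => (X₀ ω, ξ₀ ω)) ∧
    CondLawIs P₀ T (fun ω => (X₀ ω, ξ₀ ω)) (fun _ => cond volume (box (0 : Fin d → ℤ))) ∧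
    CondLawIs P₀ S (fun ω => ((X₀ ω, ξ₀ ω), T ω)) (fun ω => uniformOn (centredCell (ξ ω))) ∧
    IsPalmVersion P₀ (fun ω => (X₀ ω, ξ₀ ω)) P (fun ω => (X ω, ξ ω)) := by
  obtain rfl : S = fun ω => offset (ξ ω) 0 := funext hS
  let Z : Ω → E × LocFinMeasure d := fun ω => (X ω, ξ ω)
  have hZ : Measurable Z := hX.prodMk hξ
  have hσM : SigmaFinite (P.map Z) := hσ
  have hM : IsShiftInvariant (P.map Z) := fun t => by
    rw [Measure.map_map (g := pairShift t) (measurable_const.pairShift measurable_id) hZ]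
    exact hstat t
  have hfin : ∀ᵐ ω ∂P, (cell (ξ ω) 0).Finite := hconv.mono fun _ h => finite_cell h 0
  have hSm : Measurable fun ω => offset (ξ ω) 0 := measurable_offset_zero.comp hξ
  have hlat : Measurable (lat : (Fin d → ℤ) → Vec d) := Measurable.of_discrete
  have hZ₀m : Measurable fun ω => (X₀ ω, ξ₀ ω) := by
    simp_rw [hZ₀]
    exact hT.pairShift ((hlat.comp hSm).neg.pairShift hZ)
  have key : ∀ g : E × LocFinMeasure d → Vec d → (Fin d → ℤ) → ℝ≥0∞,
      (Measurable fun p : (E × LocFinMeasure d) × Vec d × (Fin d → ℤ) => g p.1 p.2.1 p.2.2) →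
      ∫⁻ ω, g (X₀ ω, ξ₀ ω) (T ω) (offset (ξ ω) 0) ∂P₀ =
        ∫⁻ z, ∫⁻ t in box 0, ∫⁻ j, g (pairShift t z) t j ∂cellKernel d z.2 ∂z.2.1 ∂P.map Z := by
    intro g hg
    simp_rw [hZ₀]
    rw [hP₀]
    exact lintegral_recentred_law hZ hM hconv hT hTcond hg
  have key' : ∀ g : E × LocFinMeasure d → Vec d → ℝ≥0∞, Measurable (Function.uncurry g) →
      ∫⁻ ω, g (X₀ ω, ξ₀ ω) (T ω) ∂P₀ =
        ∫⁻ z, ∫⁻ t in box 0, g (pairShift t z) t ∂z.2.1 ∂P.map Z := by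
    intro g hg
    rw [key (fun z t _ => g z t) (hg.comp (measurable_fst.prodMk measurable_snd.fst))]
    simp
  have hlaw : P₀.map (fun ω => (X₀ ω, ξ₀ ω)) = palm (P.map Z) := by
    refine Measure.ext_of_lintegral _ fun f hf => ?_
    rw [lintegral_map hf hZ₀m, lintegral_palm hf]
    exact key' (fun z _ => f z) (hf.comp measurable_fst)
  have hbox : cond volume (box (0 : Fin d → ℤ)) = volume.restrict (box (0 : Fin d → ℤ)) := by
    rw [ProbabilityTheory.cond, volume_box_zero, inv_one, one_smul]
  have hbox_prob : IsProbabilityMeasure (cond volume (box (0 : Fin d → ℤ))) :=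
    cond_isProbabilityMeasure_of_finite (by simp [volume_box_zero]) (by simp [volume_box_zero])
  -- Campbell's formula with the integrand cut to the unit box turns the law of the pair and `T`
  -- into a product of the Palm measure and the uniform law.
  have hlawT : P₀.map (fun ω => ((X₀ ω, ξ₀ ω), T ω)) =
      palm (P.map Z) ⊗ₘ Kernel.const _ (cond volume (box (0 : Fin d → ℤ))) := by
    refine Measure.ext_of_lintegral _ fun g hg => ?_
    have hgi : Measurable (Function.uncurry fun (z : E × LocFinMeasure d) t =>
        (box (0 : Fin d → ℤ)).indicator (fun t => g (z, t)) t) :=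
      hg.indicator (measurable_snd (measurableSet_box 0))
    have hC := lintegral_campbell hM hgi
    simp_rw [lintegral_indicator (measurableSet_box 0)] at hC
    rw [lintegral_map hg (hZ₀m.prodMk hT), Measure.lintegral_compProd hg]
    simp_rw [Kernel.const_apply, hbox]
    rw [← hC, key' (fun z t => g (z, t)) hg]
    refine lintegral_congr fun z => ?_
    rw [← lintegral_indicator (measurableSet_box 0)]
    rfl
  have : SFinite (P₀.map fun ω => ((X₀ ω, ξ₀ ω), T ω)) := by
    rw [hlawT]
    infer_instance
  have hPP₀ : ae P₀ ≤ ae P := by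
    rw [hP₀]
    exact (withDensity_absolutelyContinuous _ _).ae_le
  refine ⟨hfin, isMassStationary_of_map_eq_palm hM hZ₀m.aemeasurable hlaw,
    ⟨Kernel.const _ (cond volume (box 0)), inferInstance, ⟨(hZ₀m.prodMk hT).aemeasurable, ?_⟩,
      .of_forall fun _ => rfl⟩, ?_, fun f hf B hB hB0 hBtop => ?_⟩
  · rw [hlaw, hlawT]
  -- Shifting back by `T` recovers `θ_{-S}(X, ξ)`, whose cell at the origin is `D°`. So the uniform
  -- law on `D°` is a kernel in the conditioning variables.
  · have hback : Measurable fun p : (E × LocFinMeasure d) × Vec d => (pairShift (-p.2) p.1).2 :=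
      (measurable_snd.neg.pairShift measurable_fst).snd
    refine ⟨(cellKernel d).comap _ hback, inferInstance,
      ⟨((hZ₀m.prodMk hT).prodMk hSm).aemeasurable, ?_⟩, ?_⟩
    · refine Measure.ext_of_lintegral _ fun g hg => ?_
      have hint : Measurable fun p : (E × LocFinMeasure d) × Vec d =>
          ∫⁻ j, g (p, j) ∂(cellKernel d).comap _ hback p := hg.lintegral_kernel_prod_right'
      rw [lintegral_map hg ((hZ₀m.prodMk hT).prodMk hSm), Measure.lintegral_compProd hg,
        lintegral_map hint (hZ₀m.prodMk hT),
        key (fun z t j => g ((z, t), j)) (hg.comp ((measurable_fst.prodMk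
          measurable_snd.fst).prodMk measurable_snd.snd)),
        key' (fun z t => ∫⁻ j, g ((z, t), j) ∂(cellKernel d).comap _ hback (z, t)) hint]
      simp only [Kernel.comap_apply, pairShift_neg_pairShift]
    · filter_upwards [hPP₀ hconv] with ω hω
      have hz : (pairShift (-T ω) (X₀ ω, ξ₀ ω)).2 = shift (-lat (offset (ξ ω) 0)) (ξ ω) := by
        rw [hZ₀, pairShift_neg_pairShift]
        rfl
      have hcell := cell_shift_offset (latticePoints_nonempty hω)
      have hcfin : (cell (shift (-lat (offset (ξ ω) 0)) (ξ ω)) 0).Finite := by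
        rw [hcell]
        exact (finite_cell hω 0).image _
      rw [Kernel.comap_apply, hz, cellKernel_apply hcfin, hcell]
  · have hin : Measurable fun z : E × LocFinMeasure d =>
        ∫⁻ t in B, f (pairShift t z) ∂z.2.1 :=
      measurable_snd.setLIntegral_locFinMeasure (f := fun z t => f (pairShift t z))
        (hf.comp (measurable_snd.pairShift measurable_fst)) hB
    rw [ENNReal.eq_div_iff hB0.ne' hBtop.ne, mul_comm, ← lintegral_map hf hZ₀m, hlaw,
      lintegral_palm_mul_volume hM hf hB, lintegral_map hin hZ]
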